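/- \textbf{Model.} Let $G$ be a simple graph on the vertex set $\{1,\dots,n\}$ with $m$ edges, $n\le 2m$ (for instance, without isolated vertices), and let $T\ge 1$ be its number of 4-cycles. For an edge $e$ let $N_e$ be the number of 4-cycles that contain $e$. The edges of $G$ arrive one at a time, each exactly once, in an arbitrary order. A perfect heavy-edge oracle with threshold $\tau$ reports, for each arriving edge $e$, whether $N_e\ge\tau$. A one-pass algorithm is randomized; it keeps between arrivals only a memory state, and its space is the largest number of bits of this state during the pass. It knows $n$, $\epsilon$ and a constant-factor approximation $\hat T$ of $T$. \textbf{Theorem.} For every constant $B\ge 1$ there are one-pass algorithms (one for each choice of $n,\epsilon,\hat T$) and constants $K,k$, depending only on $B$, such that the following holds for every such graph $G$, every order of its edges, every $0<\epsilon<1$, every $\hat T$ with $T/B\le\hat T\le BT$, and every perfect heavy-edge oracle with a threshold $\tau$ satisfying $T^{2/3}/B\le\tau\le B\,T^{2/3}$ (for instance $\tau=T^{2/3}$ or $\tau=\hat T^{2/3}$). Put \[ f = T^{1/3}+\epsilon^{-2}\,\frac{m}{T^{1/3}},\qquad s=K\,f\,(\log f)^k=\tilde O\!\left(T^{1/3}+\epsilon^{-2}\,\frac{m}{T^{1/3}}\right).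 \] Then the algorithm uses expected space at most $s$ bits, and with probability at least $7/10$ its output is a $(1\pm\epsilon)$-approximation of $T$ (that is, it differs from $T$ by at most $\epsilon T$) while its space is at most $s$ bits. -/

import Mathlib

open scoped ENNReal

section FourCycles

variable {V : Type*} [Fintype V] [DecidableEq V]

/-- `C` is the edge set of a 4-cycle `a - b - c - d - a` of `G` (four distinct vertices;
the inequalities that are not listed follow from adjacency). -/
def IsFourCycle (G : SimpleGraph V) (C : Finset (Sym2 V)) : Prop :=
  ∃ a b c d : V, G.Adj a b ∧ G.Adj b c ∧ G.Adj c d ∧ G.Adj d a ∧ a ≠ c ∧ b ≠ d ∧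
    C = {s(a, b), s(b, c), s(c, d), s(d, a)}

open Classical in
/-- The set of all 4-cycles of `G`, each one represented by its edge set. -/
noncomputable def fourCycles (G : SimpleGraph V) : Finset (Finset (Sym2 V)) :=
  Finset.univ.filter fun C => IsFourCycle G C

/-- The number `T` of 4-cycles of `G`. -/
noncomputable def fourCycleCount (G : SimpleGraph V) : ℕ :=
  (fourCycles G).card

/-- The number `N_e` of 4-cycles of `G` that contain the edge `e`. -/
noncomputable def edgeFourCycleCount (G : SimpleGraph V) (e : Sym2 V) : ℕ :=
  ((fourCycles G).filter fun C => e ∈ C).card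

/-- `O` is a perfect heavy-edge oracle for `G` with threshold `τ`: on an edge `e` of `G` it answers
`true` (heavy) exactly when at least `τ` 4-cycles contain `e`. -/
def IsHeavyEdgeOracle (G : SimpleGraph V) (τ : ℝ) (O : Sym2 V → Bool) : Prop :=
  ∀ e ∈ G.edgeSet, (O e = true ↔ τ ≤ (edgeFourCycleCount G e : ℝ))

/-- `σ` is an arbitrary-order edge stream of `G`: it lists every edge of `G` exactly once. -/
def IsEdgeStream (G : SimpleGraph V) (σ : List (Sym2 V)) : Prop :=
  σ.Nodup ∧ ∀ e, e ∈ σ ↔ e ∈ G.edgeSet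

end FourCycles

/-- A randomized one-pass streaming algorithm with oracle access, for graphs on the vertex set
`Fin n`. All that it keeps from one arrival to the next is its memory state, which is written down
as a bit string. When an edge arrives it sees this edge and the answer of the oracle on it, and
moves to a new state, using fresh random coins. After the last edge it outputs a real number that
depends on its final state only. -/
structure OracleStreamAlgorithm (n : ℕ) where
  State : Type
  encode : State → List Bool
  encode_injective : Function.Injective encode
  init : PMF State
  step : State → Sym2 (Fin n) → Bool → PMF State
  output : State → ℝ

namespace OracleStreamAlgorithm

variable {n : ℕ} (A : OracleStreamAlgorithm n)

/-- The number of memory bits in a state. -/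
def space (s : A.State) : ℕ := (A.encode s).length

/-- One arrival: the state changes, and the peak memory so far (second component) is updated. -/
noncomputable def advance (O : Sym2 (Fin n) → Bool) (x : A.State × ℕ) (e : Sym2 (Fin n)) :
    PMF (A.State × ℕ) :=
  (A.step x.1 e (O e)).map fun s => (s, max x.2 (A.space s))

/-- The joint law of the final state and of the peak memory (in bits) over the whole pass, when the
algorithm reads the stream `σ` with the oracle `O`. -/
noncomputable def run (O : Sym2 (Fin n) → Bool) (σ : List (Sym2 (Fin n))) : PMF (A.State × ℕ) :=
  σ.foldl (fun μ e => μ.bind fun x => A.advance O x e) (A.init.map fun s => (s, A.space s))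

/-- Expected peak memory, in bits. -/
noncomputable def expectedSpace (O : Sym2 (Fin n) → Bool) (σ : List (Sym2 (Fin n))) : ℝ≥0∞ :=
  ∑' x : A.State × ℕ, A.run O σ x * (x.2 : ℝ≥0∞)

/-- Probability that the output is a `(1 ± ε)`-approximation of `T` and that, in the same run, the
peak memory is at most `s` bits. -/
noncomputable def successProb (O : Sym2 (Fin n) → Bool) (σ : List (Sym2 (Fin n)))
    (ε T s : ℝ) : ℝ≥0∞ :=
  (A.run O σ).toOuterMeasure {x | |A.output x.1 - T| ≤ ε * T ∧ (x.2 : ℝ) ≤ s}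

end OracleStreamAlgorithm

/-- The quantity `T ^ (1/3) + ε⁻² m / T ^ (1/3)`. -/
noncomputable def spaceScale (m T ε : ℝ) : ℝ :=
  T ^ ((1 : ℝ) / 3) + m / (ε ^ 2 * T ^ ((1 : ℝ) / 3))

/-!
# Counting 4-cycles in one pass with a heavy-edge oracle

Every 4-cycle is detected when the last of its four edges arrives. With a choice of one of its two
pairs of opposite vertices it is a quadruple `(a, b, c, d)` whose closing edge is `cd` and whose
chosen pair is `a`, `c`; there are `2 T` of these (`card_closedQuads`). The algorithm stores all
heavy edges, every edge with probability `p ≈ log n / (ε² T^(1/3))`, and all edges that touch one of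
two random vertex sets `R₁`, `R₂` of rate `p`. A pair is *crowded* at a given time if it has about
`T^(1/3)` common neighbours or more; the sample `R₁` decides this (with the threshold
`θ ≈ log n / ε²` for the number of sampled common neighbours), and by Chernoff's bound it does so
correctly for all pairs and times that matter, up to a constant factor
(`pmfProb_not_goodSample_le`).

* A cycle with no crowded pair is counted when its light non-closing edges are all in the edge
  sample.
* A cycle with a crowded pair `a`, `c` is counted when the other two vertices `b`, `d` belong to
  `R₂`; if `b`, `d` is crowded too, then the cycle is counted from both sides, with weight `1 / 2`.

Weighted by inverse probabilities these two estimators are unbiased, given `R₁`, and their sum has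
mean `T` (`sum_weights`). Their variances are controlled by one inequality
(`pmfMean_htEstimator_sub_sq_le`): it suffices that for every nonempty set `D` the number of
quadruples whose required sample contains `D`, times `(1 / p - 1) ^ |D|`, is `O(T / θ)`.

* Cycles without a crowded pair (`sparse_overlap_le`): a light edge lies on `O(T^(2/3))` cycles; a
  path of two edges lies on `O(T^(1/3))` of them, because the fourth vertices are all common
  neighbours of its ends when the last of the cycles is closed (`card_filter_path_le`); two opposite
  edges lie on `O(1)` cycles.
* Crowded pairs (`crowded_overlap_le`): the squares of the numbers of common neighbours of the
  crowded pairs add up to `O(T)`, since two common neighbours make a 4-cycle. Hence there are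
  `O(T^(1/3))` crowded pairs, and the numbers of their common neighbours add up to `O(T^(2/3))`.

Chebyshev's inequality gives the accuracy. For the space, the memory is written with a prefix code.
The final stored sets bound its length at all times, and they have expected total size
`O(p (n + m) + T^(1/3))`, because `4 T` bounds the sum of `N_e` over the heavy edges. As `n ≤ 2 m`
and `m` is at most the square of the space scale, all logarithms are `O(log f)`. The run of the
algorithm is reduced to the three samples in `run_fourCycleAlgorithm`; its coins for the edges are
tossed on arrival, so the law of the edge sample is built up along the stream.
-/

/-! ### Expectations under a probability mass function on a finite type -/

/-- Expectation of a real function under a probability mass function on a finite type. -/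
noncomputable def pmfMean {Ω : Type*} [Fintype Ω] (μ : PMF Ω) (g : Ω → ℝ) : ℝ :=
  ∑ ω, (μ ω).toReal * g ω

section Mean

variable {Ω Ω' ι : Type*} [Fintype Ω] [Fintype Ω'] (μ : PMF Ω)

lemma pmf_sum_toReal : ∑ ω, (μ ω).toReal = 1 := by
  rw [← ENNReal.toReal_sum fun ω _ => μ.apply_ne_top ω, ← tsum_fintype (L := .unconditional _),
    μ.tsum_coe, ENNReal.toReal_one]

lemma pmfMean_const (c : ℝ) : pmfMean μ (fun _ => c) = c := by
  simp only [pmfMean, ← Finset.sum_mul, pmf_sum_toReal, one_mul]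

lemma pmfMean_pure (ω : Ω) (g : Ω → ℝ) : pmfMean (PMF.pure ω) g = g ω := by
  classical
  unfold pmfMean
  rw [Finset.sum_eq_single ω]
  · simp
  · intro b _ hb
    simp [PMF.pure_apply, hb]
  · simp

lemma pmfMean_bind (f : Ω → PMF Ω') (g : Ω' → ℝ) :
    pmfMean (μ.bind f) g = pmfMean μ fun ω => pmfMean (f ω) g := by
  unfold pmfMean
  simp only [PMF.bind_apply, tsum_fintype, Finset.mul_sum]
  rw [Finset.sum_comm]
  refine Finset.sum_congr rfl fun ω' _ => ?_
  rw [ENNReal.toReal_sum fun ω _ => ENNReal.mul_ne_top (μ.apply_ne_top ω) ((f ω).apply_ne_top ω'),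
    Finset.sum_mul]
  refine Finset.sum_congr rfl fun ω _ => ?_
  rw [ENNReal.toReal_mul, mul_assoc]

lemma pmfMean_map (f : Ω → Ω') (g : Ω' → ℝ) :
    pmfMean (μ.map f) g = pmfMean μ fun ω => g (f ω) := by
  rw [← PMF.bind_pure_comp, pmfMean_bind]
  simp [pmfMean_pure]

lemma pmfMean_add (g h : Ω → ℝ) :
    pmfMean μ (fun ω => g ω + h ω) = pmfMean μ g + pmfMean μ h := by
  simp only [pmfMean, mul_add, Finset.sum_add_distrib]

lemma pmfMean_mul_left (c : ℝ) (g : Ω → ℝ) :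
    pmfMean μ (fun ω => c * g ω) = c * pmfMean μ g := by
  simp only [pmfMean, Finset.mul_sum]
  exact Finset.sum_congr rfl fun ω _ => by ring

lemma pmfMean_sub (g h : Ω → ℝ) :
    pmfMean μ (fun ω => g ω - h ω) = pmfMean μ g - pmfMean μ h := by
  simp only [pmfMean, mul_sub, Finset.sum_sub_distrib]

lemma pmfMean_sum (J : Finset ι) (g : ι → Ω → ℝ) :
    pmfMean μ (fun ω => ∑ j ∈ J, g j ω) = ∑ j ∈ J, pmfMean μ (g j) := by
  simp only [pmfMean, Finset.mul_sum]
  exact Finset.sum_comm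

lemma pmfMean_mono {g h : Ω → ℝ} (hgh : ∀ ω, g ω ≤ h ω) : pmfMean μ g ≤ pmfMean μ h :=
  Finset.sum_le_sum fun ω _ => mul_le_mul_of_nonneg_left (hgh ω) ENNReal.toReal_nonneg

lemma pmfMean_le_of_le {g : Ω → ℝ} {c : ℝ} (h : ∀ ω, g ω ≤ c) : pmfMean μ g ≤ c :=
  (pmfMean_mono μ h).trans_eq (pmfMean_const μ c)

open Classical in
/-- The probability of an event under a probability mass function on a finite type, as a real
number. -/
noncomputable def pmfProb (μ : PMF Ω) (s : Ω → Prop) : ℝ :=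
  pmfMean μ fun ω => if s ω then 1 else 0

open Classical in
lemma toOuterMeasure_eq_ofReal_pmfProb (s : Set Ω) :
    μ.toOuterMeasure s = ENNReal.ofReal (pmfProb μ fun ω => ω ∈ s) := by
  rw [PMF.toOuterMeasure_apply, tsum_fintype, pmfProb, pmfMean, ENNReal.ofReal_sum_of_nonneg]
  · refine Finset.sum_congr rfl fun ω _ => ?_
    by_cases h : ω ∈ s <;> simp [h, ENNReal.ofReal_toReal, μ.apply_ne_top]
  · intro ω _
    split_ifs <;> simp

lemma pmfProb_not (s : Ω → Prop) : pmfProb μ (fun ω => ¬ s ω) = 1 - pmfProb μ s := by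
  classical
  unfold pmfProb
  rw [show (1 : ℝ) - _ = _ from congrArg (· - _) (pmfMean_const μ (1 : ℝ)).symm, ← pmfMean_sub]
  congr 1
  funext ω
  by_cases h : s ω <;> simp [h]

lemma pmfProb_mono {s t : Ω → Prop} (h : ∀ ω, s ω → t ω) : pmfProb μ s ≤ pmfProb μ t := by
  classical
  refine pmfMean_mono μ fun ω => ?_
  by_cases hs : s ω
  · simp [hs, h ω hs]
  · simp only [hs, if_false]
    split_ifs <;> norm_num

lemma pmfProb_or_le (s t : Ω → Prop) :
    pmfProb μ (fun ω => s ω ∨ t ω) ≤ pmfProb μ s + pmfProb μ t := by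
  classical
  unfold pmfProb
  rw [← pmfMean_add]
  refine pmfMean_mono μ fun ω => ?_
  by_cases hs : s ω <;> by_cases ht : t ω <;> simp [hs, ht]

lemma pmfProb_exists_le (J : Finset ι) (s : ι → Ω → Prop) :
    pmfProb μ (fun ω => ∃ j ∈ J, s j ω) ≤ ∑ j ∈ J, pmfProb μ (s j) := by
  classical
  unfold pmfProb
  rw [← pmfMean_sum]
  refine pmfMean_mono μ fun ω => ?_
  by_cases hs : ∃ j ∈ J, s j ω
  · obtain ⟨j, hj, h⟩ := hs
    rw [if_pos ⟨j, hj, h⟩]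
    calc (1 : ℝ) = if s j ω then 1 else 0 := by simp [h]
      _ ≤ _ := Finset.single_le_sum (f := fun j => if s j ω then (1 : ℝ) else 0)
          (fun i _ => by split_ifs <;> norm_num) hj
  · rw [if_neg hs]
    exact Finset.sum_nonneg fun i _ => by split_ifs <;> norm_num

/-- Markov's inequality. -/
lemma pmfProb_le_div (g : Ω → ℝ) (hg : ∀ ω, 0 ≤ g ω) {a : ℝ} (ha : 0 < a) {s : Ω → Prop}
    (hs : ∀ ω, s ω → a ≤ g ω) : pmfProb μ s ≤ pmfMean μ g / a := by
  classical
  rw [le_div_iff₀ ha, mul_comm]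
  unfold pmfProb
  rw [← pmfMean_mul_left]
  refine pmfMean_mono μ fun ω => ?_
  by_cases h : s ω
  · simpa [h] using hs ω h
  · simpa [h] using hg ω

/-- Chebyshev's inequality, around any point `c`. -/
lemma pmfProb_lt_abs_sub_le (g : Ω → ℝ) (c : ℝ) {a : ℝ} (ha : 0 < a) :
    pmfProb μ (fun ω => a < |g ω - c|) ≤ pmfMean μ (fun ω => (g ω - c) ^ 2) / a ^ 2 := by
  refine pmfProb_le_div μ _ (fun ω => sq_nonneg _) (by positivity) fun ω h => ?_
  rw [← sq_abs (g ω - c)]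
  exact pow_le_pow_left₀ ha.le h.le 2

/-- The product of two probability mass functions. -/
noncomputable def pmfProd {α β : Type*} (μ : PMF α) (ν : PMF β) : PMF (α × β) :=
  μ.bind fun a => ν.map fun b => (a, b)

lemma pmfMean_pmfProd (ν : PMF Ω') (g : Ω × Ω' → ℝ) :
    pmfMean (pmfProd μ ν) g = pmfMean μ fun a => pmfMean ν fun b => g (a, b) := by
  rw [pmfProd, pmfMean_bind]
  simp only [pmfMean_map]

lemma pmfProb_pmfProd (ν : PMF Ω') (s : Ω × Ω' → Prop) :
    pmfProb (pmfProd μ ν) s = pmfMean μ fun a => pmfProb ν fun b => s (a, b) := by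
  unfold pmfProb
  exact pmfMean_pmfProd μ ν _

end Mean

/-! ### Random subsets -/

/-- A coin that shows `true` with probability `p`. -/
noncomputable def coin (p : unitInterval) : PMF Bool :=
  PMF.ofFintype (fun b => ENNReal.ofReal (if b then p else 1 - p)) (by
    rw [Fintype.sum_bool, ← ENNReal.ofReal_add]
    · simp
    · simpa using p.2.1
    · simpa using p.2.2)

lemma pmfMean_coin (p : unitInterval) (g : Bool → ℝ) :
    pmfMean (coin p) g = p * g true + (1 - p) * g false := by
  have h1 := p.2.1
  have h2 := p.2.2
  simp [pmfMean, coin, PMF.ofFintype_apply, ENNReal.toReal_ofReal, h1, h2]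

/-- Puts `e` into `S`, or removes it, according to the outcome of a coin. -/
def updateMem {α : Type*} [DecidableEq α] (e : α) (S : Finset α) (b : Bool) : Finset α :=
  if b then insert e S else S.erase e

/-- The random subset of the entries of `l` that contains each of them independently with
probability `p`; the coins are tossed along the list. -/
noncomputable def randomSubset {α : Type*} [DecidableEq α] (p : unitInterval) (l : List α) :
    PMF (Finset α) :=
  l.foldl (fun μ e => μ.bind fun S => (coin p).map (updateMem e S)) (PMF.pure ∅)

lemma randomSubset_concat {α : Type*} [DecidableEq α] (p : unitInterval) (l : List α) (e : α) :
    randomSubset p (l ++ [e]) =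
      (randomSubset p l).bind fun S => (coin p).map (updateMem e S) := by
  simp [randomSubset, List.foldl_append]

section RandomSubset

variable {α : Type*} [DecidableEq α] [Fintype α] (p : unitInterval)

/-- Membership of the entries in a random subset is independent. -/
lemma pmfMean_randomSubset_prod {l : List α} (hl : l.Nodup) (f : α → Bool → ℝ) :
    pmfMean (randomSubset p l) (fun S => ∏ e ∈ l.toFinset, f e (decide (e ∈ S))) =
      ∏ e ∈ l.toFinset, (p * f e true + (1 - p) * f e false) := by
  induction l using List.reverseRecOn with
  | nil => simp [pmfMean_const]
  | append_singleton l e ih =>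
    have hnd : l.Nodup := (List.nodup_append.1 hl).1
    have he : e ∉ l.toFinset := by
      rw [List.mem_toFinset]
      intro h
      exact (List.nodup_append.1 hl).2.2 e h e (by simp) rfl
    have hfin : (l ++ [e]).toFinset = insert e l.toFinset := by
      ext x; simp
    rw [hfin, Finset.prod_insert he, ← ih hnd, randomSubset_concat, pmfMean_bind,
      ← pmfMean_mul_left]
    congr 1
    funext S
    rw [pmfMean_map, pmfMean_coin, Finset.prod_insert he, Finset.prod_insert he]
    have h : ∀ b, ∏ x ∈ l.toFinset, f x (decide (x ∈ updateMem e S b)) =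
        ∏ x ∈ l.toFinset, f x (decide (x ∈ S)) := by
      intro b
      refine Finset.prod_congr rfl fun x hx => ?_
      have hxe : x ≠ e := fun h => he (h ▸ hx)
      cases b <;> simp [updateMem, hxe]
    rw [h, h]
    simp only [updateMem, if_true, Finset.mem_insert_self, decide_true, Bool.false_eq_true,
      if_false, Finset.mem_erase, ne_eq, not_true_eq_false, false_and, decide_false]
    ring

lemma pmfMean_randomSubset_subset {l : List α} (hl : l.Nodup) {D : Finset α}
    (hD : D ⊆ l.toFinset) :
    pmfMean (randomSubset p l) (fun S => if D ⊆ S then 1 else 0) = (p : ℝ) ^ D.card := by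
  have h := pmfMean_randomSubset_prod p hl
    (fun e b => if e ∈ D then (if b then 1 else 0) else 1)
  have h1 : ∀ S : Finset α, (∏ e ∈ l.toFinset,
      if e ∈ D then (if decide (e ∈ S) = true then (1 : ℝ) else 0) else 1) =
      if D ⊆ S then 1 else 0 := by
    intro S
    rw [← Finset.prod_filter, Finset.filter_mem_eq_inter, Finset.inter_eq_right.2 hD]
    simp only [decide_eq_true_eq]
    rw [Finset.prod_ite_zero]
    simp [Finset.subset_iff]
  simp only [h1] at h
  rw [h, Finset.prod_congr rfl (g := fun e => if e ∈ D then (p : ℝ) else 1) fun e _ => by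
    by_cases he : e ∈ D <;> simp [he], ← Finset.prod_filter, Finset.filter_mem_eq_inter, Finset.inter_eq_right.2 hD,
    Finset.prod_const]

lemma pmfMean_randomSubset_mem {l : List α} (hl : l.Nodup) {e : α} (he : e ∈ l) :
    pmfMean (randomSubset p l) (fun S => if e ∈ S then 1 else 0) = p := by
  have h := pmfMean_randomSubset_subset p hl (D := {e}) (by simpa using he)
  simpa using h

lemma pmfMean_randomSubset_pow {l : List α} (hl : l.Nodup) {D : Finset α}
    (hD : D ⊆ l.toFinset) (c : ℝ) :
    pmfMean (randomSubset p l) (fun S => c ^ (D ∩ S).card) = (1 + p * (c - 1)) ^ D.card := by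
  have h := pmfMean_randomSubset_prod p hl
    (fun e b => if e ∈ D then (if b then c else 1) else 1)
  have h1 : ∀ S : Finset α, (∏ e ∈ l.toFinset,
      if e ∈ D then (if decide (e ∈ S) = true then c else 1) else 1) = c ^ (D ∩ S).card := by
    intro S
    rw [← Finset.prod_filter, Finset.filter_mem_eq_inter, Finset.inter_eq_right.2 hD]
    simp only [decide_eq_true_eq]
    rw [← Finset.prod_filter, Finset.filter_mem_eq_inter, Finset.prod_const]
  simp only [h1] at h
  rw [h, Finset.prod_congr rfl (g := fun e => if e ∈ D then 1 + (p : ℝ) * (c - 1) else 1) fun e _ => by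
    by_cases he : e ∈ D <;> simp [he]
    ring, ← Finset.prod_filter, Finset.filter_mem_eq_inter, Finset.inter_eq_right.2 hD,
    Finset.prod_const]

/-- Chernoff's bound, upper tail. -/
lemma pmfProb_randomSubset_ge {l : List α} (hl : l.Nodup) {D : Finset α}
    (hD : D ⊆ l.toFinset) {θ : ℝ} (hθ : (p : ℝ) * D.card ≤ θ / 4) :
    pmfProb (randomSubset p l) (fun S => θ ≤ ((D ∩ S).card : ℝ)) ≤ Real.exp (-(θ / 2)) := by
  have h := pmfProb_le_div (randomSubset p l) (fun S => Real.exp 1 ^ (D ∩ S).card)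
    (fun _ => by positivity) (Real.exp_pos θ) (s := fun S => θ ≤ ((D ∩ S).card : ℝ))
    (fun S hS => by
      rw [← Real.exp_nat_mul, mul_one]
      exact Real.exp_le_exp.2 hS)
  refine h.trans ?_
  rw [pmfMean_randomSubset_pow p hl hD, div_eq_mul_inv, ← Real.exp_neg]
  have hp := p.2.1
  have he : Real.exp 1 < 3 := Real.exp_one_lt_d9.trans (by norm_num)
  have he1 : (1 : ℝ) ≤ Real.exp 1 := Real.one_le_exp (by norm_num)
  have hb : (1 + (p : ℝ) * (Real.exp 1 - 1)) ≤ Real.exp (2 * p) := by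
    have := Real.add_one_le_exp (2 * (p : ℝ))
    nlinarith
  calc (1 + (p : ℝ) * (Real.exp 1 - 1)) ^ D.card * Real.exp (-θ)
      ≤ Real.exp (2 * p) ^ D.card * Real.exp (-θ) := by
        refine mul_le_mul_of_nonneg_right (pow_le_pow_left₀ ?_ hb _) (Real.exp_pos _).le
        nlinarith
    _ = Real.exp (D.card * (2 * p) + -θ) := by rw [← Real.exp_nat_mul, ← Real.exp_add]
    _ ≤ _ := Real.exp_le_exp.2 (by nlinarith)

/-- Chernoff's bound, lower tail. -/
lemma pmfProb_randomSubset_lt {l : List α} (hl : l.Nodup) {D : Finset α}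
    (hD : D ⊆ l.toFinset) {θ : ℝ} (hθ : 4 * θ ≤ (p : ℝ) * D.card) (hθ0 : 0 ≤ θ) :
    pmfProb (randomSubset p l) (fun S => ((D ∩ S).card : ℝ) < θ) ≤ Real.exp (-(θ / 2)) := by
  have h := pmfProb_le_div (randomSubset p l) (fun S => Real.exp (-1) ^ (D ∩ S).card)
    (fun _ => by positivity) (Real.exp_pos (-θ)) (s := fun S => ((D ∩ S).card : ℝ) < θ)
    (fun S hS => by
      rw [← Real.exp_nat_mul]
      exact Real.exp_le_exp.2 (by linarith))
  refine h.trans ?_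
  rw [pmfMean_randomSubset_pow p hl hD, div_eq_mul_inv, ← Real.exp_neg, neg_neg]
  have hp := p.2.1
  have hp1 := p.2.2
  have he : Real.exp (-1) < 1 / 2 := Real.exp_neg_one_lt_d9.trans (by norm_num)
  have he1 : 0 < Real.exp (-1) := Real.exp_pos _
  have hb : (1 + (p : ℝ) * (Real.exp (-1) - 1)) ≤ Real.exp (-(p / 2)) := by
    have := Real.add_one_le_exp (-((p : ℝ) / 2))
    nlinarith
  calc (1 + (p : ℝ) * (Real.exp (-1) - 1)) ^ D.card * Real.exp θ
      ≤ Real.exp (-(p / 2)) ^ D.card * Real.exp θ := by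
        refine mul_le_mul_of_nonneg_right (pow_le_pow_left₀ ?_ hb _) (Real.exp_pos _).le
        nlinarith
    _ = Real.exp (D.card * (-(p / 2)) + θ) := by rw [← Real.exp_nat_mul, ← Real.exp_add]
    _ ≤ _ := Real.exp_le_exp.2 (by nlinarith)

lemma pmfMean_randomSubset_card {l : List α} (hl : l.Nodup) :
    pmfMean (randomSubset p l) (fun S => ((l.toFinset ∩ S).card : ℝ)) = p * l.length := by
  have h : ∀ S : Finset α, ((l.toFinset ∩ S).card : ℝ) =
      ∑ e ∈ l.toFinset, if e ∈ S then (1 : ℝ) else 0 := by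
    intro S
    rw [← Finset.filter_mem_eq_inter, Finset.card_filter]
    push_cast
    rfl
  simp only [h]
  rw [pmfMean_sum, Finset.sum_congr rfl fun e he =>
    pmfMean_randomSubset_mem p hl (List.mem_toFinset.1 he)]
  rw [Finset.sum_const, List.toFinset_card_of_nodup hl, nsmul_eq_mul, mul_comm]

end RandomSubset

/-! ### Inverse-probability estimators -/

section Estimator

variable {α ι : Type*} [DecidableEq α] [Fintype α] (p : unitInterval)

/-- The inverse-probability (Horvitz–Thompson) estimator of `∑ j ∈ J, w j` from a random set `S` of
rate `p`: the index `j` is observed when all elements of `M j` are sampled. -/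
noncomputable def htEstimator (J : Finset ι) (M : ι → Finset α) (w : ι → ℝ) (S : Finset α) : ℝ :=
  ∑ j ∈ J, w j * ((p : ℝ)⁻¹ ^ (M j).card * if M j ⊆ S then 1 else 0)

lemma pmfMean_htEstimator (hp : (p : ℝ) ≠ 0) {l : List α} (hl : l.Nodup) (J : Finset ι)
    {M : ι → Finset α} (hM : ∀ j ∈ J, M j ⊆ l.toFinset) (w : ι → ℝ) :
    pmfMean (randomSubset p l) (htEstimator p J M w) = ∑ j ∈ J, w j := by
  unfold htEstimator
  rw [pmfMean_sum]
  refine Finset.sum_congr rfl fun j hj => ?_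
  rw [pmfMean_mul_left, pmfMean_mul_left, pmfMean_randomSubset_subset p hl (hM j hj), ← mul_pow,
    inv_mul_cancel₀ hp, one_pow, mul_one]

lemma pmfMean_htEstimator_sq (hp : (p : ℝ) ≠ 0) {l : List α} (hl : l.Nodup) (J : Finset ι)
    {M : ι → Finset α} (hM : ∀ j ∈ J, M j ⊆ l.toFinset) (w : ι → ℝ) :
    pmfMean (randomSubset p l) (fun S => htEstimator p J M w S ^ 2) =
      ∑ j ∈ J, ∑ k ∈ J, w j * w k * (p : ℝ)⁻¹ ^ (M j ∩ M k).card := by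
  simp only [sq, htEstimator, Finset.sum_mul_sum]
  rw [pmfMean_sum]
  refine Finset.sum_congr rfl fun j hj => ?_
  rw [pmfMean_sum]
  refine Finset.sum_congr rfl fun k hk => ?_
  have h : ∀ S : Finset α, (w j * ((p : ℝ)⁻¹ ^ (M j).card * if M j ⊆ S then 1 else 0)) *
      (w k * ((p : ℝ)⁻¹ ^ (M k).card * if M k ⊆ S then 1 else 0)) =
      (w j * w k * ((p : ℝ)⁻¹ ^ (M j).card * (p : ℝ)⁻¹ ^ (M k).card)) *
        if M j ∪ M k ⊆ S then 1 else 0 := by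
    intro S
    by_cases h1 : M j ⊆ S <;> by_cases h2 : M k ⊆ S <;> simp [h1, h2, Finset.union_subset_iff]
    ring
  simp only [h]
  rw [pmfMean_mul_left, pmfMean_randomSubset_subset p hl (Finset.union_subset (hM j hj) (hM k hk)),
    ← pow_add, ← Finset.card_union_add_card_inter, pow_add, inv_pow, inv_pow]
  have : (p : ℝ) ^ (M j ∪ M k).card ≠ 0 := pow_ne_zero _ hp
  field_simp

/-- The second central moment of the estimator. With `x = 1 / p - 1` it equals
`∑ D ≠ ∅, x ^ |D| * (∑ j with D ⊆ M j, w j) ^ 2`, so it is small when no `D` is contained in many of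
the sets `M j`. -/
lemma pmfMean_htEstimator_sub_sq_le (hp : (p : ℝ) ≠ 0) {l : List α} (hl : l.Nodup) (J : Finset ι)
    {M : ι → Finset α} (hM : ∀ j ∈ J, M j ⊆ l.toFinset) (hM3 : ∀ j ∈ J, (M j).card ≤ 3)
    {w : ι → ℝ} (hw0 : ∀ j ∈ J, 0 ≤ w j) (hw1 : ∀ j ∈ J, w j ≤ 1) {β : ℝ} (hβ0 : 0 ≤ β)
    (hβ : ∀ j ∈ J, ∀ D ⊆ M j, D.Nonempty →
      ((p : ℝ)⁻¹ - 1) ^ D.card * ((J.filter fun k => D ⊆ M k).card : ℝ) ≤ β) :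
    pmfMean (randomSubset p l) (fun S => (htEstimator p J M w S - ∑ j ∈ J, w j) ^ 2) ≤
      8 * β * ∑ j ∈ J, w j := by
  classical
  set x : ℝ := (p : ℝ)⁻¹ - 1 with hx
  have hp0 : 0 < (p : ℝ) := lt_of_le_of_ne p.2.1 (Ne.symm hp)
  have hx0 : 0 ≤ x := sub_nonneg.2 ((one_le_inv₀ hp0).2 p.2.2)
  set W := ∑ j ∈ J, w j with hW
  have hvar : pmfMean (randomSubset p l) (fun S => (htEstimator p J M w S - W) ^ 2) =
      ∑ j ∈ J, ∑ k ∈ J, w j * w k * ((p : ℝ)⁻¹ ^ (M j ∩ M k).card - 1) := by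
    have h : ∀ S, (htEstimator p J M w S - W) ^ 2 =
        htEstimator p J M w S ^ 2 - ((2 * W) * htEstimator p J M w S - W ^ 2) := by
      intro S; ring
    simp only [h]
    rw [pmfMean_sub, pmfMean_sub, pmfMean_mul_left, pmfMean_const, pmfMean_htEstimator p hp hl J hM,
      pmfMean_htEstimator_sq p hp hl J hM, ← hW]
    simp only [mul_sub, mul_one, Finset.sum_sub_distrib, ← Finset.mul_sum, ← Finset.sum_mul]
    rw [← hW]
    ring
  rw [hvar, Finset.mul_sum]
  refine Finset.sum_le_sum fun j hj => ?_
  have hexp : ∀ k, (p : ℝ)⁻¹ ^ (M j ∩ M k).card - 1 =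
      ∑ D ∈ (M j).powerset.erase ∅, if D ⊆ M k then x ^ D.card else 0 := by
    intro k
    have h := Finset.sum_pow_mul_eq_add_pow x 1 (M j ∩ M k)
    simp only [one_pow, mul_one] at h
    rw [show x + 1 = (p : ℝ)⁻¹ by rw [hx]; ring] at h
    rw [← h, ← Finset.sum_filter, ← Finset.sum_erase_add _ _ (Finset.empty_mem_powerset _)]
    simp only [Finset.card_empty, pow_zero, add_sub_cancel_right]
    refine Finset.sum_congr ?_ fun _ _ => rfl
    ext D
    simp only [Finset.mem_erase, Finset.mem_powerset, Finset.subset_inter_iff, Finset.mem_filter]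
    tauto
  calc ∑ k ∈ J, w j * w k * ((p : ℝ)⁻¹ ^ (M j ∩ M k).card - 1)
      = w j * ∑ D ∈ (M j).powerset.erase ∅, ∑ k ∈ J, w k * if D ⊆ M k then x ^ D.card else 0 := by
        rw [Finset.sum_comm, Finset.mul_sum]
        refine Finset.sum_congr rfl fun k _ => ?_
        rw [hexp, mul_assoc, Finset.mul_sum]
    _ ≤ w j * ∑ _D ∈ (M j).powerset.erase ∅, β := by
        refine mul_le_mul_of_nonneg_left (Finset.sum_le_sum fun D hD => ?_) (hw0 j hj)
        rw [Finset.mem_erase, Finset.mem_powerset] at hD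
        refine le_trans ?_ (hβ j hj D hD.2 (Finset.nonempty_iff_ne_empty.2 hD.1))
        rw [Finset.card_filter, Nat.cast_sum, Finset.mul_sum]
        refine Finset.sum_le_sum fun k hk => ?_
        split_ifs
        · rw [Nat.cast_one, mul_one]
          exact mul_le_of_le_one_left (pow_nonneg hx0 _) (hw1 k hk)
        · simp
    _ ≤ w j * (8 * β) := by
        refine mul_le_mul_of_nonneg_left ?_ (hw0 j hj)
        rw [Finset.sum_const, nsmul_eq_mul]
        refine mul_le_mul_of_nonneg_right ?_ hβ0
        have h1 : ((M j).powerset.erase ∅).card ≤ 2 ^ 3 :=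
          (Finset.card_erase_le).trans
            ((Finset.card_powerset _).trans_le (Nat.pow_le_pow_right (by norm_num) (hM3 j hj)))
        exact_mod_cast h1
    _ = 8 * β * w j := by ring

end Estimator

/-! ### Prefix codes -/

/-- `enc` is uniquely decodable from the left: no code word is a proper prefix of another one, and
distinct objects have distinct code words. -/
def IsPrefixCode {α : Type*} (enc : α → List Bool) : Prop :=
  ∀ a b s t, enc a ++ s = enc b ++ t → a = b ∧ s = t

section PrefixCode

variable {α β : Type*}

lemma IsPrefixCode.injective {enc : α → List Bool} (h : IsPrefixCode enc) :
    Function.Injective enc := fun a b hab => (h a b [] [] (by rw [hab])).1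

lemma IsPrefixCode.comp {enc : β → List Bool} (h : IsPrefixCode enc) {f : α → β}
    (hf : Function.Injective f) : IsPrefixCode fun a => enc (f a) :=
  fun _ _ s t hab => ⟨hf (h _ _ s t hab).1, (h _ _ s t hab).2⟩

lemma IsPrefixCode.pair {enc : α → List Bool} {enc' : β → List Bool} (h : IsPrefixCode enc)
    (h' : IsPrefixCode enc') : IsPrefixCode fun x : α × β => enc x.1 ++ enc' x.2 := by
  rintro ⟨a, a'⟩ ⟨b, b'⟩ s t hab
  simp only [List.append_assoc] at hab
  obtain ⟨rfl, h1⟩ := h _ _ _ _ hab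
  obtain ⟨rfl, h2⟩ := h' _ _ _ _ h1
  exact ⟨rfl, h2⟩

lemma isPrefixCode_bool : IsPrefixCode fun b : Bool => [b] := by
  intro a b s t h
  simpa using h

/-- Code of a list: every entry is announced by `true`, the end by `false`. -/
def listCode (enc : α → List Bool) : List α → List Bool
  | [] => [false]
  | a :: l => true :: (enc a ++ listCode enc l)

lemma IsPrefixCode.list {enc : α → List Bool} (h : IsPrefixCode enc) :
    IsPrefixCode (listCode enc) := by
  intro k
  induction k with
  | nil =>
    rintro (_ | ⟨b, l⟩) s t hab
    · simpa [listCode] using hab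
    · simp [listCode] at hab
  | cons a k ih =>
    rintro (_ | ⟨b, l⟩) s t hab
    · simp [listCode] at hab
    · simp only [listCode, List.cons_append, List.append_assoc, List.cons.injEq, true_and] at hab
      obtain ⟨rfl, h1⟩ := h _ _ _ _ hab
      obtain ⟨rfl, h2⟩ := ih _ _ _ h1
      exact ⟨rfl, h2⟩

lemma length_listCode_le {enc : α → List Bool} {L : ℕ} (l : List α)
    (h : ∀ a ∈ l, (enc a).length ≤ L) : (listCode enc l).length ≤ l.length * (L + 1) + 1 := by
  induction l with
  | nil => simp [listCode]
  | cons a l ih =>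
    have h1 := ih fun b hb => h b (List.mem_cons_of_mem _ hb)
    have h2 := h a List.mem_cons_self
    simp only [listCode, List.length_cons, List.length_append]
    ring_nf at h1 ⊢
    omega

/-- Self-delimiting code of a natural number, through its binary digits. -/
def natCode (x : ℕ) : List Bool := listCode (fun b : Bool => [b]) x.bits

lemma isPrefixCode_natCode : IsPrefixCode natCode := by
  refine isPrefixCode_bool.list.comp (f := Nat.bits) fun x y h => ?_
  have := congrArg (fun l : List Bool => l.foldr (fun b n => Nat.bit b n) 0) h
  have key : ∀ x : ℕ, x.bits.foldr (fun b n => Nat.bit b n) 0 = x := by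
    intro x
    induction x using Nat.binaryRec' with
    | zero => simp
    | bit b n hb ih => rw [Nat.bits_append_bit n b hb, List.foldr_cons, ih]
  simpa [key] using this

lemma length_natCode_le {x N : ℕ} (h : x ≤ N) : (natCode x).length ≤ 2 * N.size + 1 := by
  have h1 := length_listCode_le (enc := fun b : Bool => [b]) (L := 1) x.bits (by simp)
  have h2 : x.bits.length ≤ N.size := by
    exact (Nat.size_eq_bits_len x).le.trans (Nat.size_le_size h)
  unfold natCode
  omega

lemma natSize_le_log {N : ℕ} (hN : 1 ≤ N) : (N.size : ℝ) ≤ 2 * Real.log N + 1 := by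
  have h1 : 2 ^ (N.size - 1) ≤ N :=
    Nat.lt_size.1 (by have := Nat.size_pos.2 hN; omega)
  have h2 : ((2 : ℝ) ^ (N.size - 1)) ≤ N := by exact_mod_cast h1
  have h3 := Real.log_le_log (by positivity) h2
  rw [Real.log_pow] at h3
  have h4 : (N.size : ℝ) ≤ ((N.size - 1 : ℕ) : ℝ) + 1 := by
    have : N.size ≤ (N.size - 1) + 1 := by omega
    exact_mod_cast this
  have h5 := Real.log_two_gt_d9
  nlinarith [Nat.cast_nonneg (α := ℝ) (N.size - 1)]

/-- Code of a finite set, given a code for its elements. -/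
noncomputable def finsetCode (enc : α → List Bool) (S : Finset α) : List Bool :=
  listCode enc S.toList

lemma IsPrefixCode.finset {enc : α → List Bool} (h : IsPrefixCode enc) :
    IsPrefixCode (finsetCode enc) := by
  classical
  exact h.list.comp fun S S' hS => by rw [← S.toList_toFinset, ← S'.toList_toFinset, hS]

lemma length_finsetCode_le {enc : α → List Bool} {L : ℕ} (h : ∀ a, (enc a).length ≤ L)
    (S : Finset α) : (finsetCode enc S).length ≤ S.card * (L + 1) + 1 := by
  simpa [finsetCode] using length_listCode_le (enc := enc) (L := L) S.toList fun a _ => h a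

/-- Code of an element of a finite type, through its number in an enumeration. -/
noncomputable def fintypeCode [Fintype α] (a : α) : List Bool :=
  natCode (Fintype.equivFin α a)

lemma isPrefixCode_fintypeCode [Fintype α] : IsPrefixCode (fintypeCode (α := α)) :=
  isPrefixCode_natCode.comp (f := fun a => (Fintype.equivFin α a : ℕ))
    (Fin.val_injective.comp (Fintype.equivFin α).injective)

lemma length_fintypeCode_le [Fintype α] {N : ℕ} (hN : Fintype.card α ≤ N) (a : α) :
    (fintypeCode a).length ≤ 2 * N.size + 1 :=
  length_natCode_le ((Fintype.equivFin α a).2.le.trans hN)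

end PrefixCode

/-! ### Closed 4-cycles along a stream -/

/-- The edges in `F` with an endpoint in `R`. -/
def touching {V : Type*} [DecidableEq V] (R : Finset V) (F : Finset (Sym2 V)) : Finset (Sym2 V) :=
  F.filter fun e => ∃ v ∈ R, v ∈ e

lemma mem_touching {V : Type*} [DecidableEq V] {R : Finset V} {F : Finset (Sym2 V)} {e : Sym2 V} :
    e ∈ touching R F ↔ e ∈ F ∧ ∃ v ∈ R, v ∈ e := by
  simp [touching]

lemma touching_subset {V : Type*} [DecidableEq V] (R : Finset V) (F : Finset (Sym2 V)) :
    touching R F ⊆ F := Finset.filter_subset _ _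

lemma touching_mono {V : Type*} [DecidableEq V] (R : Finset V) {F F' : Finset (Sym2 V)}
    (h : F ⊆ F') : touching R F ⊆ touching R F' := Finset.filter_subset_filter _ h

lemma touching_insert {V : Type*} [DecidableEq V] (R : Finset V) (F : Finset (Sym2 V)) (e : Sym2 V) :
    touching R (insert e F) =
      if ∃ v ∈ R, v ∈ e then insert e (touching R F) else touching R F := by
  unfold touching
  rw [Finset.filter_insert]

lemma idxOf_concat_self {α : Type*} [DecidableEq α] {σ : List α} {e : α} (he : e ∉ σ) : (σ ++ [e]).idxOf e = σ.length := by
  simp [List.idxOf_append, he]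

section Stream

variable {V : Type*} [Fintype V] [DecidableEq V]

/-- The common neighbours of `a` and `c` in the graph with edge set `F`. -/
def commonNbrs (F : Finset (Sym2 V)) (a c : V) : Finset V :=
  Finset.univ.filter fun v => s(a, v) ∈ F ∧ s(v, c) ∈ F

/-- The pair `a`, `c` looks crowded to the vertex sample `R`: at least `θ` common neighbours of `a`
and `c` belong to `R`. -/
def Crowded (θ : ℝ) (R : Finset V) (F : Finset (Sym2 V)) (a c : V) : Prop :=
  θ ≤ ((commonNbrs F a c ∩ R).card : ℝ)

noncomputable instance (θ : ℝ) (R : Finset V) (F : Finset (Sym2 V)) (a c : V) :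
    Decidable (Crowded θ R F a c) := Classical.dec _

/-- A quadruple `(a, b, c, d)` of vertices, thought of as the closed walk `a - b - c - d - a`
together with its edge `cd`, and with the pair `a`, `c` of opposite vertices. -/
abbrev Quad (V : Type*) := V × V × V × V

/-- The edge `cd` of the quadruple `(a, b, c, d)`. -/
def Quad.closing (q : Quad V) : Sym2 V := s(q.2.2.1, q.2.2.2)

/-- The edges `ab`, `bc`, `ad` of the quadruple `(a, b, c, d)`. -/
def Quad.inner (q : Quad V) : Finset (Sym2 V) := {s(q.1, q.2.1), s(q.2.1, q.2.2.1), s(q.1, q.2.2.2)}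

/-- The 4-cycles of a stream, each with a choice of one of its two pairs of opposite vertices:
quadruples `(a, b, c, d)` in which `cd` is the last of the four edges to arrive. The two quadruples
`(a, b, c, d)` and `(b, a, d, c)` describe the same cycle; the chosen pair of `(a, b, c, d)` is
`a`, `c`. -/
def closedQuads (σ : List (Sym2 V)) : Finset (Quad V) :=
  Finset.univ.filter fun q => (q.1 ≠ q.2.2.1 ∧ q.2.1 ≠ q.2.2.2) ∧ q.closing ∈ σ ∧
    q.inner ⊆ (σ.take (σ.idxOf q.closing)).toFinset

/-- The edges that have arrived when `q` is closed, its closing edge included. -/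
def arrivedBy (σ : List (Sym2 V)) (q : Quad V) : Finset (Sym2 V) :=
  (σ.take (σ.idxOf q.closing + 1)).toFinset

/-- The quadruples that are closed by `e`, when the edges in `F` have arrived before. -/
def newQuads (F : Finset (Sym2 V)) (e : Sym2 V) : Finset (Quad V) :=
  Finset.univ.filter fun q => (q.1 ≠ q.2.2.1 ∧ q.2.1 ≠ q.2.2.2) ∧ q.closing = e ∧ q.inner ⊆ F

/-- The closed quadruples neither of whose two pairs of opposite vertices looks crowded to `R` at
the time of closing. -/
noncomputable def sparseQuads (θ : ℝ) (R : Finset V) (σ : List (Sym2 V)) : Finset (Quad V) :=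
  (closedQuads σ).filter fun q => ¬ Crowded θ R (arrivedBy σ q) q.1 q.2.2.1 ∧
    ¬ Crowded θ R (arrivedBy σ q) q.2.1 q.2.2.2

/-- The closed quadruples whose chosen pair of opposite vertices looks crowded to `R` at the time of
closing. -/
noncomputable def crowdedQuads (θ : ℝ) (R : Finset V) (σ : List (Sym2 V)) : Finset (Quad V) :=
  (closedQuads σ).filter fun q => Crowded θ R (arrivedBy σ q) q.1 q.2.2.1

/-- The inner edges of `q` that the oracle reports as light. -/
def lightInner (O : Sym2 V → Bool) (q : Quad V) : Finset (Sym2 V) :=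
  q.inner.filter fun e => O e = false

lemma crowded_touching {R R' : Finset V} (hR : R ⊆ R') (θ : ℝ) (F : Finset (Sym2 V)) (a c : V) :
    Crowded θ R (touching R' F) a c ↔ Crowded θ R F a c := by
  have h : commonNbrs (touching R' F) a c ∩ R = commonNbrs F a c ∩ R := by
    ext v
    simp only [commonNbrs, touching, Finset.mem_inter, Finset.mem_filter, Finset.mem_univ,
      true_and]
    refine ⟨fun h => ⟨⟨h.1.1.1, h.1.2.1⟩, h.2⟩, fun h => ⟨⟨⟨h.1.1, v, hR h.2, ?_⟩,
      ⟨h.1.2, v, hR h.2, ?_⟩⟩, h.2⟩⟩ <;> simp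
  unfold Crowded
  rw [h]

lemma mem_closedQuads {σ : List (Sym2 V)} {q : Quad V} :
    q ∈ closedQuads σ ↔ (q.1 ≠ q.2.2.1 ∧ q.2.1 ≠ q.2.2.2) ∧ q.closing ∈ σ ∧
      q.inner ⊆ (σ.take (σ.idxOf q.closing)).toFinset := by
  simp [closedQuads]

lemma mem_newQuads {F : Finset (Sym2 V)} {e : Sym2 V} {q : Quad V} :
    q ∈ newQuads F e ↔ (q.1 ≠ q.2.2.1 ∧ q.2.1 ≠ q.2.2.2) ∧ q.closing = e ∧ q.inner ⊆ F := by
  simp [newQuads]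

section Concat

variable {σ : List (Sym2 V)} {e : Sym2 V}

lemma closedQuads_concat (he : e ∉ σ) :
    closedQuads (σ ++ [e]) = closedQuads σ ∪ newQuads σ.toFinset e := by
  ext q
  rw [Finset.mem_union, mem_closedQuads, mem_closedQuads, mem_newQuads]
  by_cases hq : q.closing ∈ σ
  · have hne : q.closing ≠ e := fun h => he (h ▸ hq)
    rw [List.idxOf_append_of_mem hq, List.take_append_of_le_length List.idxOf_le_length]
    simp [hq, hne]
  · by_cases hqe : q.closing = e
    · rw [hqe, idxOf_concat_self he]
      simp [he]
    · simp [hq, hqe]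

lemma disjoint_closedQuads_newQuads (he : e ∉ σ) :
    Disjoint (closedQuads σ) (newQuads σ.toFinset e) := by
  rw [Finset.disjoint_left]
  intro q h1 h2
  rw [mem_closedQuads] at h1
  rw [mem_newQuads] at h2
  exact he (h2.2.1 ▸ h1.2.1)

lemma arrivedBy_concat_of_mem {q : Quad V} (hq : q ∈ closedQuads σ) :
    arrivedBy (σ ++ [e]) q = arrivedBy σ q := by
  have h := (mem_closedQuads.1 hq).2.1
  unfold arrivedBy
  rw [List.idxOf_append_of_mem h,
    List.take_append_of_le_length (Nat.succ_le_of_lt (List.idxOf_lt_length_iff.2 h))]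

lemma arrivedBy_concat_of_new {q : Quad V} (he : e ∉ σ) (hq : q ∈ newQuads σ.toFinset e) :
    arrivedBy (σ ++ [e]) q = insert e σ.toFinset := by
  have h := (mem_newQuads.1 hq).2.1
  unfold arrivedBy
  rw [h, idxOf_concat_self he, List.take_of_length_le (by simp)]
  ext x
  simp

lemma sum_closedQuads_concat {M : Type*} [AddCommMonoid M] (he : e ∉ σ)
    (f : Finset (Sym2 V) → Quad V → M) :
    ∑ q ∈ closedQuads (σ ++ [e]), f (arrivedBy (σ ++ [e]) q) q =
      ∑ q ∈ closedQuads σ, f (arrivedBy σ q) q +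
        ∑ q ∈ newQuads σ.toFinset e, f (insert e σ.toFinset) q := by
  rw [closedQuads_concat he, Finset.sum_union (disjoint_closedQuads_newQuads he)]
  congr 1
  · exact Finset.sum_congr rfl fun q hq => by rw [arrivedBy_concat_of_mem hq]
  · exact Finset.sum_congr rfl fun q hq => by rw [arrivedBy_concat_of_new he hq]

end Concat

end Stream

/-! ### The algorithm -/

/-- The memory of the algorithm: two vertex samples, the heavy edges, the sampled edges and the
edges that touch a vertex sample, as far as they have arrived, and five counters. `sparse j` counts
the detected quadruples without a crowded pair that have `j` light inner edges, so that each counter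
belongs to one power of the sampling rate; `crowded` is twice the weighted count of the detected
crowded quadruples. -/
@[ext]
structure Memory (n : ℕ) where
  R₁ : Finset (Fin n)
  R₂ : Finset (Fin n)
  H : Finset (Sym2 (Fin n))
  S : Finset (Sym2 (Fin n))
  Q : Finset (Sym2 (Fin n))
  sparse : Fin 4 → ℕ
  crowded : ℕ

namespace Memory

variable {n : ℕ}

/-- The bit string of a memory state. -/
noncomputable def code (s : Memory n) : List Bool :=
  finsetCode fintypeCode s.R₁ ++ (finsetCode fintypeCode s.R₂ ++ (finsetCode fintypeCode s.H ++
    (finsetCode fintypeCode s.S ++ (finsetCode fintypeCode s.Q ++ (natCode (s.sparse 0) ++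
      (natCode (s.sparse 1) ++ (natCode (s.sparse 2) ++ (natCode (s.sparse 3) ++
        natCode s.crowded))))))))

lemma code_injective : Function.Injective (code (n := n)) := by
  have hv := (isPrefixCode_fintypeCode (α := Fin n)).finset
  have he := (isPrefixCode_fintypeCode (α := Sym2 (Fin n))).finset
  have hn := isPrefixCode_natCode
  have h := (hv.pair (hv.pair (he.pair (he.pair (he.pair (hn.pair (hn.pair (hn.pair
    (hn.pair hn))))))))).injective
  intro s t hst
  have h1 := @h (s.R₁, s.R₂, s.H, s.S, s.Q, s.sparse 0, s.sparse 1, s.sparse 2, s.sparse 3,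
    s.crowded) (t.R₁, t.R₂, t.H, t.S, t.Q, t.sparse 0, t.sparse 1, t.sparse 2, t.sparse 3,
    t.crowded) hst
  simp only [Prod.mk.injEq] at h1
  obtain ⟨h1, h2, h3, h4, h5, h6, h7, h8, h9, h10⟩ := h1
  ext1
  · exact h1
  · exact h2
  · exact h3
  · exact h4
  · exact h5
  · funext j
    fin_cases j <;> assumption
  · exact h10

lemma length_code_le (s : Memory n) {N : ℕ} (hn : n ^ 2 ≤ N) (hs : ∀ j, s.sparse j ≤ N)
    (hc : s.crowded ≤ N) :
    s.code.length ≤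
      (s.R₁.card + s.R₂.card + s.H.card + s.S.card + s.Q.card + 5) * (2 * N.size + 2) + 5 := by
  have hv : Fintype.card (Fin n) ≤ N := by
    rw [Fintype.card_fin]; nlinarith
  have he : Fintype.card (Sym2 (Fin n)) ≤ N := by
    refine le_trans ?_ hn
    have := Fintype.card_le_of_surjective (fun x : Fin n × Fin n => s(x.1, x.2))
      fun e => Sym2.ind (fun a b => ⟨(a, b), rfl⟩) e
    simpa [sq] using this
  have h1 := length_finsetCode_le (length_fintypeCode_le hv) s.R₁
  have h2 := length_finsetCode_le (length_fintypeCode_le hv) s.R₂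
  have h3 := length_finsetCode_le (length_fintypeCode_le he) s.H
  have h4 := length_finsetCode_le (length_fintypeCode_le he) s.S
  have h5 := length_finsetCode_le (length_fintypeCode_le he) s.Q
  have h6 := length_natCode_le (hs 0)
  have h7 := length_natCode_le (hs 1)
  have h8 := length_natCode_le (hs 2)
  have h9 := length_natCode_le (hs 3)
  have h10 := length_natCode_le hc
  simp only [code, List.length_append]
  nlinarith

/-- The change of the memory when the edge `e` arrives; `h` is the answer of the oracle and `b` the
outcome of the coin that decides whether `e` is sampled. Crowdedness is judged with the closing edge
`e` included. A crowded quadruple counts twice, or once if its other pair is crowded as well. -/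
noncomputable def next (θ : ℝ) (s : Memory n) (e : Sym2 (Fin n)) (h b : Bool) : Memory n :=
  let Q' := if ∃ v ∈ s.R₁ ∪ s.R₂, v ∈ e then insert e s.Q else s.Q
  { R₁ := s.R₁
    R₂ := s.R₂
    H := if h then insert e s.H else s.H
    S := if b then insert e s.S else s.S
    Q := Q'
    sparse := fun j => s.sparse j + ((newQuads (s.H ∪ s.S) e).filter fun q =>
      (q.inner \ s.H).card = j ∧ ¬ Crowded θ s.R₁ Q' q.1 q.2.2.1 ∧
        ¬ Crowded θ s.R₁ Q' q.2.1 q.2.2.2).card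
    crowded := s.crowded + ∑ q ∈ (newQuads s.Q e).filter fun q =>
      {q.2.1, q.2.2.2} ⊆ s.R₂ ∧ Crowded θ s.R₁ Q' q.1 q.2.2.1,
        if Crowded θ s.R₁ Q' q.2.1 q.2.2.2 then 1 else 2 }

/-- The memory after the stream `σ`, as a function of the three samples `ω = (R₁, R₂, S)`. -/
noncomputable def after (θ : ℝ) (O : Sym2 (Fin n) → Bool) (σ : List (Sym2 (Fin n)))
    (ω : Finset (Fin n) × Finset (Fin n) × Finset (Sym2 (Fin n))) : Memory n where
  R₁ := ω.1
  R₂ := ω.2.1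
  H := σ.toFinset.filter fun e => O e = true
  S := σ.toFinset ∩ ω.2.2
  Q := touching (ω.1 ∪ ω.2.1) σ.toFinset
  sparse := fun j => ((sparseQuads θ ω.1 σ).filter fun q =>
    lightInner O q ⊆ ω.2.2 ∧ (lightInner O q).card = j).card
  crowded := ∑ q ∈ (crowdedQuads θ ω.1 σ).filter fun q => {q.2.1, q.2.2.2} ⊆ ω.2.1,
    if Crowded θ ω.1 (arrivedBy σ q) q.2.1 q.2.2.2 then 1 else 2

/-- The closed form of the memory obeys the transition rule. All that an arriving edge needs is in
the memory: the counters see only heavy, sampled, and touching edges. -/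
lemma after_concat (θ : ℝ) (O : Sym2 (Fin n) → Bool) {σ : List (Sym2 (Fin n))} {e : Sym2 (Fin n)}
    (he : e ∉ σ) (R₁ R₂ : Finset (Fin n)) (S : Finset (Sym2 (Fin n))) (b : Bool) :
    after θ O (σ ++ [e]) (R₁, R₂, updateMem e S b) = (after θ O σ (R₁, R₂, S)).next θ e (O e) b := by
  have hfin : (σ ++ [e]).toFinset = insert e σ.toFinset := by
    ext x; simp
  have he' : e ∉ σ.toFinset := by simpa using he
  have hmem : ∀ x ∈ σ.toFinset, (x ∈ updateMem e S b ↔ x ∈ S) := by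
    intro x hx
    have hxe : x ≠ e := fun h => he' (h ▸ hx)
    cases b <;> simp [updateMem, hxe]
  have hQ : (if ∃ v ∈ R₁ ∪ R₂, v ∈ e then insert e (touching (R₁ ∪ R₂) σ.toFinset)
      else touching (R₁ ∪ R₂) σ.toFinset) = touching (R₁ ∪ R₂) (insert e σ.toFinset) := by
    rw [touching_insert]
    congr
  ext1
  · rfl
  · rfl
  · simp only [after, next]
    rw [hfin, Finset.filter_insert]
  · simp only [after, next]
    rw [hfin]
    ext x
    by_cases hx : x = e
    · subst hx
      cases b <;> simp [updateMem, he]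
    · cases b <;> simp [updateMem, hx]
  · simp only [after, next]
    rw [hfin, hQ]
  · funext j
    simp only [after, next, hQ, crowded_touching Finset.subset_union_left, sparseQuads]
    rw [Finset.filter_filter, Finset.filter_filter, Finset.card_filter, Finset.card_filter,
      sum_closedQuads_concat he (fun F q => if (¬ Crowded θ R₁ F q.1 q.2.2.1 ∧
        ¬ Crowded θ R₁ F q.2.1 q.2.2.2) ∧ lightInner O q ⊆ updateMem e S b ∧
          (lightInner O q).card = j then 1 else 0)]
    congr 1
    · refine Finset.sum_congr rfl fun q hq => ?_
      have hin : lightInner O q ⊆ σ.toFinset := fun x hx => by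
        have := (mem_closedQuads.1 hq).2.2 (Finset.filter_subset _ _ hx)
        rw [List.mem_toFinset] at this ⊢
        exact List.mem_of_mem_take this
      have : lightInner O q ⊆ updateMem e S b ↔ lightInner O q ⊆ S :=
        forall₂_congr fun x hx => hmem x (hin hx)
      simp only [this]
    · rw [← Finset.card_filter]
      congr 1
      ext q
      simp only [Finset.mem_filter, mem_newQuads]
      constructor
      · rintro ⟨⟨h1, h2, h3⟩, h4, h5, h6⟩
        have hH : q.inner \ σ.toFinset.filter (fun e => O e = true) = lightInner O q := by
          ext x
          simp only [Finset.mem_sdiff, Finset.mem_filter, lightInner]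
          refine ⟨fun h => ⟨h.1, ?_⟩, fun h => ⟨h.1, fun h' => ?_⟩⟩
          · by_contra hO
            exact h.2 ⟨h3 h.1, by simpa using hO⟩
          · simp [h.2] at h'
        refine ⟨⟨h1, h2, fun x hx => ?_⟩, by rw [hH, h6], h4⟩
        rw [Finset.mem_union, Finset.mem_filter, Finset.mem_inter]
        by_cases hO : O x = true
        · exact Or.inl ⟨h3 hx, hO⟩
        · refine Or.inr ⟨h3 hx, (hmem x (h3 hx)).1 (h5 ?_)⟩
          simp only [lightInner, Finset.mem_filter]
          exact ⟨hx, by simpa using hO⟩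
      · rintro ⟨⟨h1, h2, h3⟩, h6, h4⟩
        have h3' : q.inner ⊆ σ.toFinset := fun x hx => by
          have := h3 hx
          simp only [Finset.mem_union, Finset.mem_filter, Finset.mem_inter] at this
          tauto
        have hH : q.inner \ σ.toFinset.filter (fun e => O e = true) = lightInner O q := by
          ext x
          simp only [Finset.mem_sdiff, Finset.mem_filter, lightInner]
          refine ⟨fun h => ⟨h.1, ?_⟩, fun h => ⟨h.1, fun h' => ?_⟩⟩
          · by_contra hO
            exact h.2 ⟨h3' h.1, by simpa using hO⟩
          · simp [h.2] at h'
        rw [hH] at h6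
        refine ⟨⟨h1, h2, h3'⟩, h4, fun x hx => ?_, h6⟩
        simp only [lightInner, Finset.mem_filter] at hx
        have := h3 hx.1
        simp only [Finset.mem_union, Finset.mem_filter, Finset.mem_inter, hx.2] at this
        rw [hmem x (h3' hx.1)]
        tauto
  · simp only [after, next, hQ, crowded_touching Finset.subset_union_left, crowdedQuads]
    rw [Finset.filter_filter, Finset.filter_filter, Finset.sum_filter, Finset.sum_filter,
      sum_closedQuads_concat he (fun F q => if Crowded θ R₁ F q.1 q.2.2.1 ∧
        {q.2.1, q.2.2.2} ⊆ R₂ then (if Crowded θ R₁ F q.2.1 q.2.2.2 then 1 else 2) else 0)]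
    congr 1
    rw [← Finset.sum_filter]
    refine Finset.sum_congr ?_ fun _ _ => rfl
    ext q
    simp only [Finset.mem_filter, mem_newQuads]
    constructor
    · rintro ⟨⟨h1, h2, h3⟩, h4, h5⟩
      refine ⟨⟨h1, h2, fun x hx => ?_⟩, h5, h4⟩
      have hb : q.2.1 ∈ R₂ := h5 (by simp)
      have hd : q.2.2.2 ∈ R₂ := h5 (by simp)
      simp only [mem_touching, Finset.mem_union]
      refine ⟨h3 hx, ?_⟩
      simp only [Quad.inner, Finset.mem_insert, Finset.mem_singleton] at hx
      rcases hx with rfl | rfl | rfl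
      · exact ⟨_, Or.inr hb, by simp⟩
      · exact ⟨_, Or.inr hb, by simp⟩
      · exact ⟨_, Or.inr hd, by simp⟩
    · rintro ⟨⟨h1, h2, h3⟩, h5, h4⟩
      exact ⟨⟨h1, h2, h3.trans (touching_subset _ _)⟩, h4, h5⟩

/-- The memory after a stream depends only on the part of the edge sample that has arrived. -/
lemma after_updateMem (θ : ℝ) (O : Sym2 (Fin n) → Bool) {σ : List (Sym2 (Fin n))}
    {e : Sym2 (Fin n)} (he : e ∉ σ) (R₁ R₂ : Finset (Fin n)) (S : Finset (Sym2 (Fin n))) (b : Bool) :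
    after θ O σ (R₁, R₂, updateMem e S b) = after θ O σ (R₁, R₂, S) := by
  have hmem : ∀ x ∈ σ.toFinset, (x ∈ updateMem e S b ↔ x ∈ S) := by
    intro x hx
    have hxe : x ≠ e := fun h => he (h ▸ by simpa using hx)
    cases b <;> simp [updateMem, hxe]
  ext1
  · rfl
  · rfl
  · rfl
  · ext x
    simp only [after, Finset.mem_inter]
    exact and_congr_right (hmem x)
  · rfl
  · funext j
    simp only [after]
    congr 1
    refine Finset.filter_congr fun q hq => ?_
    have hin : lightInner O q ⊆ σ.toFinset := fun x hx => by
      have := (mem_closedQuads.1 (Finset.mem_filter.1 hq).1).2.2 (Finset.filter_subset _ _ hx)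
      rw [List.mem_toFinset] at this ⊢
      exact List.mem_of_mem_take this
    have : lightInner O q ⊆ updateMem e S b ↔ lightInner O q ⊆ S :=
      forall₂_congr fun x hx => hmem x (hin hx)
    rw [this]
  · rfl

/-- The number of edges and vertices that are stored at the end of the stream, where an edge is
counted once for each of the sets that contain it. -/
noncomputable def stored (O : Sym2 (Fin n) → Bool) (σ : List (Sym2 (Fin n)))
    (ω : Finset (Fin n) × Finset (Fin n) × Finset (Sym2 (Fin n))) : ℕ :=
  ω.1.card + ω.2.1.card + (σ.toFinset.filter fun e => O e = true).card +
    (σ.toFinset ∩ ω.2.2).card + (touching (ω.1 ∪ ω.2.1) σ.toFinset).card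

lemma length_code_after_take_le (θ : ℝ) (O : Sym2 (Fin n) → Bool) (σ : List (Sym2 (Fin n)))
    (ω : Finset (Fin n) × Finset (Fin n) × Finset (Sym2 (Fin n))) (i : ℕ) :
    (after θ O (σ.take i) ω).code.length ≤
      (stored O σ ω + 5) * (2 * (2 * n ^ 4).size + 2) + 5 := by
  have hsub : (σ.take i).toFinset ⊆ σ.toFinset := fun x hx => by
    rw [List.mem_toFinset] at hx ⊢
    exact List.mem_of_mem_take hx
  have hquad : ∀ P : Finset (Quad (Fin n)), P.card ≤ n ^ 4 := fun P => by
    refine (Finset.card_le_univ P).trans_eq ?_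
    simp only [Quad, Fintype.card_prod, Fintype.card_fin]
    ring
  refine (length_code_le (after θ O (σ.take i) ω) (N := 2 * n ^ 4) ?_ ?_ ?_).trans ?_
  · rcases Nat.eq_zero_or_pos n with rfl | hn
    · simp
    · have := Nat.pow_le_pow_right hn (show 2 ≤ 4 by norm_num)
      omega
  · intro j
    refine (hquad _).trans ?_
    omega
  · refine (Finset.sum_le_card_nsmul _ _ 2 fun q _ => by split_ifs <;> norm_num).trans ?_
    rw [smul_eq_mul, mul_comm]
    exact Nat.mul_le_mul_left _ (hquad _)
  · refine Nat.add_le_add_right (Nat.mul_le_mul_right _ (Nat.add_le_add_right ?_ _)) _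
    simp only [stored, after]
    gcongr
    exact touching_mono _ hsub

end Memory

section Algorithm

variable {n : ℕ}

/-- The one-pass algorithm with sampling rate `p` and crowdedness threshold `θ`. The vertex samples
are drawn before the pass; the coin of an edge is tossed when it arrives. -/
noncomputable def fourCycleAlgorithm (n : ℕ) (p : unitInterval) (θ : ℝ) :
    OracleStreamAlgorithm n where
  State := Memory n
  encode := Memory.code
  encode_injective := Memory.code_injective
  init := (pmfProd (randomSubset p (List.finRange n)) (randomSubset p (List.finRange n))).map
    fun R => ⟨R.1, R.2, ∅, ∅, ∅, 0, 0⟩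
  step := fun s e h => (coin p).map (s.next θ e h)
  output := fun s => (∑ j : Fin 4, (s.sparse j : ℝ) * ((1 / 2) * (p : ℝ)⁻¹ ^ (j : ℕ))) +
    s.crowded / 2 * (p : ℝ)⁻¹ ^ 2

/-- The law of the two vertex samples and of the edge sample. -/
noncomputable def samples (p : unitInterval) (σ : List (Sym2 (Fin n))) :
    PMF (Finset (Fin n) × Finset (Fin n) × Finset (Sym2 (Fin n))) :=
  pmfProd (randomSubset p (List.finRange n))
    (pmfProd (randomSubset p (List.finRange n)) (randomSubset p σ))

lemma samples_concat (p : unitInterval) (σ : List (Sym2 (Fin n))) (e : Sym2 (Fin n)) :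
    samples p (σ ++ [e]) = (samples p σ).bind fun ω =>
      (coin p).map fun b => (ω.1, ω.2.1, updateMem e ω.2.2 b) := by
  simp only [samples, pmfProd, randomSubset_concat, PMF.map_bind, PMF.bind_bind, PMF.bind_map,
    PMF.map_comp, Function.comp_def]

/-- The peak memory in bits, as a function of the samples. The edge sample `ω.2.2` of the whole
stream is used for every prefix, which sees only the part of it that has arrived. -/
noncomputable def peakMemory (θ : ℝ) (O : Sym2 (Fin n) → Bool) (σ : List (Sym2 (Fin n)))
    (ω : Finset (Fin n) × Finset (Fin n) × Finset (Sym2 (Fin n))) : ℕ :=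
  (Finset.range (σ.length + 1)).sup fun i => (Memory.after θ O (σ.take i) ω).code.length

lemma peakMemory_concat (θ : ℝ) (O : Sym2 (Fin n) → Bool) {σ : List (Sym2 (Fin n))}
    {e : Sym2 (Fin n)} (he : e ∉ σ) (R₁ R₂ : Finset (Fin n)) (S : Finset (Sym2 (Fin n))) (b : Bool) :
    peakMemory θ O (σ ++ [e]) (R₁, R₂, updateMem e S b) =
      max (peakMemory θ O σ (R₁, R₂, S))
        (Memory.after θ O (σ ++ [e]) (R₁, R₂, updateMem e S b)).code.length := by
  unfold peakMemory
  rw [List.length_append, List.length_singleton, Finset.range_add_one, Finset.sup_insert,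
    max_comm]
  congr 1
  · refine Finset.sup_congr rfl fun i hi => ?_
    rw [Finset.mem_range] at hi
    rw [List.take_append_of_le_length (Nat.lt_succ_iff.1 hi),
      Memory.after_updateMem θ O fun h => he (List.mem_of_mem_take h)]
  · rw [List.take_of_length_le (by simp)]

/-- The run of the algorithm is determined by its three samples. -/
lemma run_fourCycleAlgorithm (p : unitInterval) (θ : ℝ) (O : Sym2 (Fin n) → Bool)
    {σ : List (Sym2 (Fin n))} (hσ : σ.Nodup) :
    (fourCycleAlgorithm n p θ).run O σ =
      (samples p σ).map fun ω => (Memory.after θ O σ ω, peakMemory θ O σ ω) := by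
  induction σ using List.reverseRecOn with
  | nil =>
    have h : ∀ ω : Finset (Fin n) × Finset (Fin n) × Finset (Sym2 (Fin n)),
        Memory.after θ O [] ω = ⟨ω.1, ω.2.1, ∅, ∅, ∅, 0, 0⟩ := by
      intro ω
      have h0 : closedQuads ([] : List (Sym2 (Fin n))) = ∅ := by
        simp [closedQuads]
      simp only [Memory.after, sparseQuads, crowdedQuads, h0]
      simp [touching]
      rfl
    simp only [OracleStreamAlgorithm.run, List.foldl_nil, fourCycleAlgorithm, samples, pmfProd,
      randomSubset, PMF.map_bind, PMF.map_comp, Function.comp_def, peakMemory, h,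
      OracleStreamAlgorithm.space, List.length_nil, List.take_nil]
    simp [PMF.map, Function.comp_def]
  | append_singleton σ e ih =>
    have hnd : σ.Nodup := (List.nodup_append.1 hσ).1
    have he : e ∉ σ := fun h => (List.nodup_append.1 hσ).2.2 e h e (by simp) rfl
    have h1 : (fourCycleAlgorithm n p θ).run O (σ ++ [e]) =
        ((fourCycleAlgorithm n p θ).run O σ).bind fun x =>
          (fourCycleAlgorithm n p θ).advance O x e := by
      simp [OracleStreamAlgorithm.run, List.foldl_append]
    rw [h1, samples_concat, PMF.map_bind]
    refine (congrArg (fun μ => PMF.bind μ _) (ih hnd)).trans ((PMF.bind_map _ _ _).trans ?_)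
    congr 1
    funext ω
    simp only [Function.comp_def, OracleStreamAlgorithm.advance, fourCycleAlgorithm, PMF.map_comp,
      OracleStreamAlgorithm.space]
    congr 1
    funext b
    rw [peakMemory_concat θ O he, Memory.after_concat θ O he]

lemma tsum_pmf_map_mul {Ω β : Type*} [Fintype Ω] (μ : PMF Ω) (g : Ω → β) (F : β → ℕ) :
    ∑' x, (μ.map g) x * (F x : ℝ≥0∞) = ENNReal.ofReal (pmfMean μ fun ω => (F (g ω) : ℝ)) := by
  classical
  have h : ∀ x, (μ.map g) x * (F x : ℝ≥0∞) =
      ∑' ω, if x = g ω then μ ω * (F (g ω) : ℝ≥0∞) else 0 := by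
    intro x
    rw [PMF.map_apply, ← ENNReal.tsum_mul_right]
    refine tsum_congr fun ω => ?_
    split_ifs with hx
    · rw [hx]
    · simp
  rw [tsum_congr h, ENNReal.tsum_comm]
  simp only [tsum_ite_eq]
  rw [tsum_fintype, pmfMean, ENNReal.ofReal_sum_of_nonneg fun _ _ => by positivity]
  refine Finset.sum_congr rfl fun ω _ => ?_
  rw [ENNReal.ofReal_mul ENNReal.toReal_nonneg, ENNReal.ofReal_toReal (PMF.apply_ne_top _ _),
    ENNReal.ofReal_natCast]

lemma expectedSpace_fourCycleAlgorithm (p : unitInterval) (θ : ℝ) (O : Sym2 (Fin n) → Bool)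
    {σ : List (Sym2 (Fin n))} (hσ : σ.Nodup) :
    (fourCycleAlgorithm n p θ).expectedSpace O σ =
      ENNReal.ofReal (pmfMean (samples p σ) fun ω => (peakMemory θ O σ ω : ℝ)) := by
  unfold OracleStreamAlgorithm.expectedSpace
  rw [run_fourCycleAlgorithm p θ O hσ]
  exact tsum_pmf_map_mul (samples p σ) (fun ω => (Memory.after θ O σ ω, peakMemory θ O σ ω)) Prod.snd

lemma successProb_fourCycleAlgorithm (p : unitInterval) (θ : ℝ) (O : Sym2 (Fin n) → Bool)
    {σ : List (Sym2 (Fin n))} (hσ : σ.Nodup) (ε T s : ℝ) :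
    (fourCycleAlgorithm n p θ).successProb O σ ε T s =
      ENNReal.ofReal (pmfProb (samples p σ) fun ω =>
        |(fourCycleAlgorithm n p θ).output (Memory.after θ O σ ω) - T| ≤ ε * T ∧
          (peakMemory θ O σ ω : ℝ) ≤ s) := by
  unfold OracleStreamAlgorithm.successProb
  rw [run_fourCycleAlgorithm p θ O hσ]
  refine (PMF.toOuterMeasure_map_apply _ _ _).trans ?_
  rw [toOuterMeasure_eq_ofReal_pmfProb]
  rfl

/-- The weight of a crowded quadruple: if both pairs of opposite vertices look crowded, then the
cycle is counted from both sides. -/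
noncomputable def crowdedWeight (θ : ℝ) (R : Finset (Fin n)) (σ : List (Sym2 (Fin n)))
    (q : Quad (Fin n)) : ℝ :=
  if Crowded θ R (arrivedBy σ q) q.2.1 q.2.2.2 then 1 / 2 else 1

/-- The output is the sum of two inverse-probability estimators. -/
lemma output_fourCycleAlgorithm (p : unitInterval) (θ : ℝ) (O : Sym2 (Fin n) → Bool)
    (σ : List (Sym2 (Fin n))) (R₁ R₂ : Finset (Fin n)) (S : Finset (Sym2 (Fin n))) :
    (fourCycleAlgorithm n p θ).output (Memory.after θ O σ (R₁, R₂, S)) =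
      htEstimator p (sparseQuads θ R₁ σ) (lightInner O) (fun _ => 1 / 2) S +
        htEstimator p (crowdedQuads θ R₁ σ) (fun q => {q.2.1, q.2.2.2})
          (crowdedWeight θ R₁ σ) R₂ := by
  simp only [fourCycleAlgorithm, Memory.after, htEstimator]
  congr 1
  · have hcard : ∀ q : Quad (Fin n), (lightInner O q).card ∈ Set.Iio 4 := fun q =>
      Nat.lt_succ_of_le ((Finset.card_filter_le _ _).trans Finset.card_le_three)
    simp only [Finset.card_filter, Nat.cast_sum, Finset.sum_mul]
    rw [Finset.sum_comm]
    refine Finset.sum_congr rfl fun q _ => ?_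
    rw [Finset.sum_eq_single (⟨(lightInner O q).card, hcard q⟩ : Fin 4)]
    · by_cases h : lightInner O q ⊆ S <;> simp [h]
    · intro j _ hj
      rw [if_neg, Nat.cast_zero, zero_mul]
      rintro ⟨-, h⟩
      exact hj (Fin.ext h.symm)
    · simp
  · rw [Finset.sum_filter, Nat.cast_sum, Finset.sum_div, Finset.sum_mul]
    refine Finset.sum_congr rfl fun q hq => ?_
    have hne : q.2.1 ≠ q.2.2.2 := (mem_closedQuads.1 (Finset.mem_filter.1 hq).1).1.2
    rw [Finset.card_pair hne, crowdedWeight]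
    split_ifs <;> simp

/-! ### Space -/

lemma pmfMean_samples_fst (p : unitInterval) (σ : List (Sym2 (Fin n))) (g : Finset (Fin n) → ℝ) :
    pmfMean (samples p σ) (fun ω => g ω.1) = pmfMean (randomSubset p (List.finRange n)) g := by
  simp only [samples, pmfMean_pmfProd, pmfMean_const]

lemma pmfMean_samples_snd (p : unitInterval) (σ : List (Sym2 (Fin n))) (g : Finset (Fin n) → ℝ) :
    pmfMean (samples p σ) (fun ω => g ω.2.1) = pmfMean (randomSubset p (List.finRange n)) g := by
  simp only [samples, pmfMean_pmfProd, pmfMean_const]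

lemma pmfMean_samples_edges (p : unitInterval) (σ : List (Sym2 (Fin n)))
    (g : Finset (Sym2 (Fin n)) → ℝ) :
    pmfMean (samples p σ) (fun ω => g ω.2.2) = pmfMean (randomSubset p σ) g := by
  simp only [samples, pmfMean_pmfProd, pmfMean_const]

lemma pmfMean_card_vertexSample (p : unitInterval) :
    pmfMean (randomSubset p (List.finRange n)) (fun R => (R.card : ℝ)) = p * n := by
  have h := pmfMean_randomSubset_card p (List.nodup_finRange n)
  have h1 : (List.finRange n).toFinset = Finset.univ := by ext; simp
  simpa [h1] using h

lemma pmfMean_card_touching_le (p : unitInterval) (F : Finset (Sym2 (Fin n))) :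
    pmfMean (randomSubset p (List.finRange n)) (fun R => ((touching R F).card : ℝ)) ≤
      2 * p * F.card := by
  have h : ∀ R : Finset (Fin n), ((touching R F).card : ℝ) ≤
      ∑ e ∈ F, ∑ v ∈ e.toFinset, if v ∈ R then (1 : ℝ) else 0 := by
    intro R
    rw [touching, Finset.card_filter, Nat.cast_sum]
    refine Finset.sum_le_sum fun e _ => ?_
    split_ifs with hv
    · obtain ⟨v, hv, hve⟩ := hv
      refine le_trans ?_ (Finset.single_le_sum (f := fun v => if v ∈ R then (1 : ℝ) else 0)
        (fun i _ => by split_ifs <;> norm_num) (Sym2.mem_toFinset.2 hve))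
      simp [hv]
    · exact_mod_cast Finset.sum_nonneg fun i _ => by split_ifs <;> norm_num
  refine (pmfMean_mono _ h).trans ?_
  rw [pmfMean_sum]
  have h2 : ∀ e ∈ F, pmfMean (randomSubset p (List.finRange n))
      (fun R => ∑ v ∈ e.toFinset, if v ∈ R then (1 : ℝ) else 0) ≤ 2 * p := by
    intro e _
    rw [pmfMean_sum, Finset.sum_congr rfl fun v _ =>
      pmfMean_randomSubset_mem p (List.nodup_finRange n) (List.mem_finRange v), Finset.sum_const,
      nsmul_eq_mul]
    refine mul_le_mul_of_nonneg_right ?_ p.2.1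
    have : e.toFinset.card ≤ 2 := by
      induction e with
      | _ a b =>
        rw [Sym2.toFinset_mk_eq]
        exact Finset.card_le_two
    exact_mod_cast this
  refine (Finset.sum_le_card_nsmul F _ _ h2).trans_eq ?_
  rw [nsmul_eq_mul]
  ring

lemma card_touching_union_le (R R' : Finset (Fin n)) (F : Finset (Sym2 (Fin n))) :
    (touching (R ∪ R') F).card ≤ (touching R F).card + (touching R' F).card := by
  refine (Finset.card_le_card fun e he => ?_).trans (Finset.card_union_le _ _)
  simp only [Finset.mem_union, mem_touching] at he ⊢
  obtain ⟨h, v, hv | hv, hve⟩ := he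
  · exact Or.inl ⟨h, v, hv, hve⟩
  · exact Or.inr ⟨h, v, hv, hve⟩

lemma pmfMean_stored_le (p : unitInterval) (O : Sym2 (Fin n) → Bool)
    {σ : List (Sym2 (Fin n))} (hσ : σ.Nodup) :
    pmfMean (samples p σ) (fun ω => (Memory.stored O σ ω : ℝ)) ≤
      2 * (p * n) + 5 * (p * σ.length) + (σ.toFinset.filter fun e => O e = true).card := by
  have h : ∀ ω, (Memory.stored O σ ω : ℝ) ≤ (ω.1.card : ℝ) + ((ω.2.1.card : ℝ) +
      (((σ.toFinset ∩ ω.2.2).card : ℝ) + (((touching ω.1 σ.toFinset).card : ℝ) +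
        (((touching ω.2.1 σ.toFinset).card : ℝ) +
          ((σ.toFinset.filter fun e => O e = true).card : ℝ))))) := by
    intro ω
    have := card_touching_union_le ω.1 ω.2.1 σ.toFinset
    have h2 : ((touching (ω.1 ∪ ω.2.1) σ.toFinset).card : ℝ) ≤
      (touching ω.1 σ.toFinset).card + (touching ω.2.1 σ.toFinset).card := by exact_mod_cast this
    simp only [Memory.stored, Nat.cast_add]
    linarith
  refine (pmfMean_mono _ h).trans ?_
  simp only [pmfMean_add, pmfMean_const]
  rw [pmfMean_samples_fst p σ (fun R => (R.card : ℝ)),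
    pmfMean_samples_snd p σ (fun R => (R.card : ℝ)),
    pmfMean_samples_edges p σ (fun S => ((σ.toFinset ∩ S).card : ℝ)),
    pmfMean_samples_fst p σ (fun R => ((touching R σ.toFinset).card : ℝ)),
    pmfMean_samples_snd p σ (fun R => ((touching R σ.toFinset).card : ℝ)),
    pmfMean_card_vertexSample, pmfMean_randomSubset_card p hσ]
  have h3 := pmfMean_card_touching_le p σ.toFinset
  rw [List.toFinset_card_of_nodup hσ] at h3
  linarith

lemma peakMemory_le (θ : ℝ) (O : Sym2 (Fin n) → Bool) (σ : List (Sym2 (Fin n)))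
    (ω : Finset (Fin n) × Finset (Fin n) × Finset (Sym2 (Fin n))) :
    peakMemory θ O σ ω ≤ (Memory.stored O σ ω + 5) * (2 * (2 * n ^ 4).size + 2) + 5 :=
  Finset.sup_le fun i _ => Memory.length_code_after_take_le θ O σ ω i

end Algorithm

/-! ### Quadruples and 4-cycles -/

section Cycles

variable {V : Type*}

/-- The same cycle and the same closing edge, with the other pair of opposite vertices. -/
def Quad.swap (q : Quad V) : Quad V := (q.2.1, q.1, q.2.2.2, q.2.2.1)

lemma Quad.closing_swap (q : Quad V) : q.swap.closing = q.closing := Sym2.eq_swap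

variable [DecidableEq V]

/-- The four edges of a quadruple. -/
def Quad.edges (q : Quad V) : Finset (Sym2 V) := insert q.closing q.inner

/-- The four vertices of a quadruple. -/
def Quad.verts (q : Quad V) : Finset V := {q.1, q.2.1, q.2.2.1, q.2.2.2}

lemma Quad.inner_swap (q : Quad V) : q.swap.inner = q.inner := by
  ext e
  simp only [Quad.inner, Quad.swap, Finset.mem_insert, Finset.mem_singleton,
    Sym2.eq_swap (a := q.2.1) (b := q.1)]
  tauto

lemma Quad.edges_swap (q : Quad V) : q.swap.edges = q.edges := by
  rw [Quad.edges, Quad.edges, Quad.closing_swap, Quad.inner_swap]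

lemma Quad.mem_verts_iff (q : Quad V) (v : V) : v ∈ q.verts ↔ ∃ e ∈ q.edges, v ∈ e := by
  simp only [Quad.verts, Quad.edges, Quad.closing, Quad.inner, Finset.mem_insert,
    Finset.mem_singleton, exists_eq_or_imp, exists_eq_left, Sym2.mem_iff]
  tauto

lemma Quad.card_verts_le (q : Quad V) : q.verts.card ≤ 4 := Finset.card_le_four

lemma card_quads_le {W : Finset V} (hW : W.card ≤ 4) {A : Finset (Quad V)}
    (hA : ∀ q ∈ A, q.verts ⊆ W) : A.card ≤ 256 := by
  have h : A ⊆ W ×ˢ W ×ˢ W ×ˢ W := by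
    intro q hq
    have := hA q hq
    simp only [Quad.verts, Finset.insert_subset_iff, Finset.singleton_subset_iff] at this
    simpa only [Finset.mem_product] using this
  refine (Finset.card_le_card h).trans ?_
  simp only [Finset.card_product]
  calc W.card * (W.card * (W.card * W.card)) ≤ 4 * (4 * (4 * 4)) := by gcongr
    _ = 256 := by norm_num

lemma mem_take_iff_idxOf_lt_of_nodup {α : Type*} [DecidableEq α] {l : List α} {x : α} {i : ℕ}
    (hl : l.Nodup) : x ∈ l.take i ↔ x ∈ l ∧ l.idxOf x < i := by
  rw [List.mem_take_iff_getElem]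
  constructor
  · rintro ⟨j, hj, rfl⟩
    refine ⟨List.getElem_mem _, ?_⟩
    rw [hl.idxOf_getElem]
    omega
  · rintro ⟨hx, hi⟩
    have := List.idxOf_lt_length_iff.2 hx
    exact ⟨l.idxOf x, by omega, List.getElem_idxOf _⟩

lemma arrivedBy_swap (σ : List (Sym2 V)) (q : Quad V) : arrivedBy σ q.swap = arrivedBy σ q := by
  rw [arrivedBy, arrivedBy, Quad.closing_swap]

lemma arrivedBy_subset (σ : List (Sym2 V)) (q : Quad V) : arrivedBy σ q ⊆ σ.toFinset := by
  intro x hx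
  rw [arrivedBy, List.mem_toFinset] at hx
  rw [List.mem_toFinset]
  exact List.mem_of_mem_take hx

/-- Two opposite edges determine the vertices of a 4-cycle. -/
lemma card_filter_opposite_le {a b c d : V} (hab : a ≠ b) (hac : a ≠ c) (had : a ≠ d)
    (hbc : b ≠ c) (hbd : b ≠ d) (hcd : c ≠ d) (J : Finset (Quad V)) :
    (J.filter fun k => s(b, c) ∈ k.inner ∧ s(a, d) ∈ k.inner).card ≤ 256 := by
  have hcard : ({a, b, c, d} : Finset V).card = 4 := by
    rw [Finset.card_insert_of_notMem, Finset.card_insert_of_notMem, Finset.card_pair hcd] <;>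
      simp [*]
  refine card_quads_le (W := {a, b, c, d}) hcard.le fun k hk => ?_
  rw [Finset.mem_filter] at hk
  have hsub : ({a, b, c, d} : Finset V) ⊆ k.verts := by
    intro v hv
    rw [Quad.mem_verts_iff]
    simp only [Finset.mem_insert, Finset.mem_singleton] at hv
    rcases hv with rfl | rfl | rfl | rfl
    · exact ⟨_, Finset.mem_insert_of_mem hk.2.2, by simp⟩
    · exact ⟨_, Finset.mem_insert_of_mem hk.2.1, by simp⟩
    · exact ⟨_, Finset.mem_insert_of_mem hk.2.1, by simp⟩
    · exact ⟨_, Finset.mem_insert_of_mem hk.2.2, by simp⟩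
  exact (Finset.eq_of_subset_of_card_le hsub (k.card_verts_le.trans hcard.ge)).ge

variable {G : SimpleGraph V} {σ : List (Sym2 V)}

lemma IsEdgeStream.adj_iff (hσ : IsEdgeStream G σ) (a b : V) :
    s(a, b) ∈ σ.toFinset ↔ G.Adj a b := by
  rw [List.mem_toFinset, hσ.2, SimpleGraph.mem_edgeSet]

/-- A 4-cycle can be written with any prescribed edge of it as the closing edge. -/
lemma IsFourCycle.exists_closing {C : Finset (Sym2 V)} (hC : IsFourCycle G C) {e : Sym2 V}
    (he : e ∈ C) : ∃ a b c d : V, (G.Adj a b ∧ G.Adj b c ∧ G.Adj c d ∧ G.Adj a d ∧ a ≠ c ∧ b ≠ d) ∧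
      s(c, d) = e ∧ Quad.edges (a, b, c, d) = C := by
  obtain ⟨a, b, c, d, h1, h2, h3, h4, hac, hbd, rfl⟩ := hC
  have key : ∀ a b c d : V, Quad.edges (a, b, c, d) = {s(a, b), s(b, c), s(c, d), s(d, a)} := by
    intro a b c d
    ext x
    simp only [Quad.edges, Quad.closing, Quad.inner, Finset.mem_insert, Finset.mem_singleton,
      Sym2.eq_swap (a := d) (b := a)]
    tauto
  simp only [Finset.mem_insert, Finset.mem_singleton] at he
  rcases he with rfl | rfl | rfl | rfl
  · refine ⟨c, d, a, b, ⟨h3, h4, h1, h2.symm, hac.symm, hbd.symm⟩, rfl, ?_⟩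
    rw [key]; ext x; simp only [Finset.mem_insert, Finset.mem_singleton]; tauto
  · refine ⟨d, a, b, c, ⟨h4, h1, h2, h3.symm, hbd.symm, hac⟩, rfl, ?_⟩
    rw [key]; ext x; simp only [Finset.mem_insert, Finset.mem_singleton]; tauto
  · exact ⟨a, b, c, d, ⟨h1, h2, h3, h4.symm, hac, hbd⟩, rfl, key a b c d⟩
  · refine ⟨b, c, d, a, ⟨h2, h3, h4, h1.symm, hbd, hac.symm⟩, rfl, ?_⟩
    rw [key]; ext x; simp only [Finset.mem_insert, Finset.mem_singleton]; tauto

/-- The edge set of a 4-cycle and its closing edge, with a direction, determine the quadruple. -/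
lemma eq_of_edges_eq_of_adj {a b c d a' b' : V} (hab : G.Adj a b) (hbc : G.Adj b c)
    (hcd : G.Adj c d) (had : G.Adj a d) (hac : a ≠ c) (hbd : b ≠ d) (hac' : a' ≠ c) (hbd' : b' ≠ d)
    (h : Quad.edges (a', b', c, d) = Quad.edges (a, b, c, d)) : a' = a ∧ b' = b := by
  have h1 : s(b', c) ∈ Quad.edges (a, b, c, d) := by
    rw [← h]; simp [Quad.edges, Quad.inner]
  have h2 : s(a', d) ∈ Quad.edges (a, b, c, d) := by
    rw [← h]; simp [Quad.edges, Quad.inner]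
  have e1 := hab.ne
  have e2 := hbc.ne
  have e3 := hcd.ne
  have e4 := had.ne
  simp only [Quad.edges, Quad.closing, Quad.inner, Finset.mem_insert, Finset.mem_singleton,
    Sym2.eq_iff] at h1 h2
  constructor <;> grind

variable [Fintype V]

/-- The quadruples all of whose four edges belong to `F`. -/
def fullQuads (F : Finset (Sym2 V)) : Finset (Quad V) :=
  Finset.univ.filter fun q => (q.1 ≠ q.2.2.1 ∧ q.2.1 ≠ q.2.2.2) ∧ q.edges ⊆ F

lemma mem_fullQuads {F : Finset (Sym2 V)} {q : Quad V} :
    q ∈ fullQuads F ↔ (q.1 ≠ q.2.2.1 ∧ q.2.1 ≠ q.2.2.2) ∧ q.edges ⊆ F := by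
  simp [fullQuads]

lemma closedQuads_subset_fullQuads (σ : List (Sym2 V)) :
    closedQuads σ ⊆ fullQuads σ.toFinset := by
  intro q hq
  rw [mem_closedQuads] at hq
  rw [mem_fullQuads]
  refine ⟨hq.1, ?_⟩
  rw [Quad.edges, Finset.insert_subset_iff]
  refine ⟨by simpa using hq.2.1, hq.2.2.trans fun x hx => ?_⟩
  rw [List.mem_toFinset] at hx ⊢
  exact List.mem_of_mem_take hx

lemma mem_fourCycles {G : SimpleGraph V} {C : Finset (Sym2 V)} :
    C ∈ fourCycles G ↔ IsFourCycle G C := by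
  classical
  simp [fourCycles]

lemma mem_fullQuads_iff_adj (hσ : IsEdgeStream G σ) {a b c d : V} :
    (a, b, c, d) ∈ fullQuads σ.toFinset ↔
      (a ≠ c ∧ b ≠ d) ∧ G.Adj a b ∧ G.Adj b c ∧ G.Adj c d ∧ G.Adj a d := by
  rw [mem_fullQuads]
  simp only [Quad.edges, Quad.closing, Quad.inner, Finset.insert_subset_iff,
    Finset.singleton_subset_iff, hσ.adj_iff]
  tauto

lemma edges_mem_fourCycles (hσ : IsEdgeStream G σ) {q : Quad V}
    (hq : q ∈ fullQuads σ.toFinset) : q.edges ∈ fourCycles G := by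
  obtain ⟨a, b, c, d⟩ := q
  rw [mem_fullQuads_iff_adj hσ] at hq
  obtain ⟨⟨hac, hbd⟩, h1, h2, h3, h4⟩ := hq
  refine mem_fourCycles.2 ⟨a, b, c, d, h1, h2, h3, h4.symm, hac, hbd, ?_⟩
  ext e
  simp only [Quad.edges, Quad.closing, Quad.inner, Finset.mem_insert, Finset.mem_singleton,
    Sym2.eq_swap (a := d) (b := a)]
  tauto

lemma card_fullQuads_edges_eq_le (F : Finset (Sym2 V)) (C : Finset (Sym2 V)) :
    ((fullQuads F).filter fun q => q.edges = C).card ≤ 256 := by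
  rcases ((fullQuads F).filter fun q => q.edges = C).eq_empty_or_nonempty with h | ⟨q₀, hq₀⟩
  · rw [h]; simp
  · refine card_quads_le q₀.card_verts_le fun q hq v hv => ?_
    rw [Finset.mem_filter] at hq hq₀
    rw [Quad.mem_verts_iff] at hv ⊢
    rwa [hq₀.2, ← hq.2]

lemma card_fullQuads_filter_le (hσ : IsEdgeStream G σ) (e : Sym2 V) :
    ((fullQuads σ.toFinset).filter fun q => e ∈ q.edges).card ≤ 256 * edgeFourCycleCount G e := by
  refine Finset.card_le_mul_card_image_of_maps_to (f := Quad.edges) (fun q hq => ?_) 256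
    fun C _ => ?_
  · rw [Finset.mem_filter] at hq
    exact Finset.mem_filter.2 ⟨edges_mem_fourCycles hσ hq.1, hq.2⟩
  · refine (Finset.card_le_card ?_).trans (card_fullQuads_edges_eq_le σ.toFinset C)
    exact Finset.filter_subset_filter _ (Finset.filter_subset _ _)

lemma card_fullQuads_le (hσ : IsEdgeStream G σ) :
    (fullQuads σ.toFinset).card ≤ 256 * fourCycleCount G :=
  Finset.card_le_mul_card_image_of_maps_to (f := Quad.edges)
    (fun _ hq => edges_mem_fourCycles hσ hq) 256
    fun C _ => card_fullQuads_edges_eq_le σ.toFinset C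

/-- A heavy edge lies on many cycles, and a cycle has four edges, so there are few heavy edges. -/
lemma sum_edgeFourCycleCount_le (G : SimpleGraph V) (F : Finset (Sym2 V)) :
    ∑ e ∈ F, edgeFourCycleCount G e ≤ 4 * fourCycleCount G := by
  simp only [edgeFourCycleCount, Finset.card_filter]
  rw [Finset.sum_comm, fourCycleCount, mul_comm, ← smul_eq_mul]
  refine Finset.sum_le_card_nsmul _ _ _ fun C hC => ?_
  obtain ⟨a, b, c, d, -, -, -, -, -, -, rfl⟩ := mem_fourCycles.1 hC
  rw [← Finset.card_filter]
  refine (Finset.card_le_card (t := {s(a, b), s(b, c), s(c, d), s(d, a)}) fun e he => ?_).trans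
    Finset.card_le_four
  exact (Finset.mem_filter.1 he).2

lemma mem_closedQuads_iff (hσ : IsEdgeStream G σ) {q : Quad V} :
    q ∈ closedQuads σ ↔ q ∈ fullQuads σ.toFinset ∧
      ∀ e ∈ q.inner, σ.idxOf e < σ.idxOf q.closing := by
  constructor
  · intro h
    refine ⟨closedQuads_subset_fullQuads σ h, fun e he => ?_⟩
    have := (mem_closedQuads.1 h).2.2 he
    rw [List.mem_toFinset, mem_take_iff_idxOf_lt_of_nodup hσ.1] at this
    exact this.2
  · rintro ⟨h1, h2⟩
    rw [mem_fullQuads, Quad.edges, Finset.insert_subset_iff] at h1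
    rw [mem_closedQuads]
    refine ⟨h1.1, by simpa using h1.2.1, fun e he => ?_⟩
    rw [List.mem_toFinset, mem_take_iff_idxOf_lt_of_nodup hσ.1]
    exact ⟨by simpa using h1.2.2 he, h2 e he⟩

lemma swap_mem_closedQuads {q : Quad V} (hq : q ∈ closedQuads σ) :
    q.swap ∈ closedQuads σ := by
  rw [mem_closedQuads, Quad.closing_swap, Quad.inner_swap]
  rw [mem_closedQuads] at hq
  exact ⟨⟨hq.1.2, hq.1.1⟩, hq.2⟩

lemma closing_eq_of_edges_eq (hσ : IsEdgeStream G σ) {q r : Quad V} (hq : q ∈ closedQuads σ)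
    (hr : r ∈ closedQuads σ) (h : q.edges = r.edges) : q.closing = r.closing := by
  by_contra hne
  have h1 : q.closing ∈ r.edges := by rw [← h]; exact Finset.mem_insert_self _ _
  have h2 : r.closing ∈ q.edges := by rw [h]; exact Finset.mem_insert_self _ _
  have h3 := ((mem_closedQuads_iff hσ).1 hr).2 _ (Finset.mem_of_mem_insert_of_ne h1 hne)
  have h4 := ((mem_closedQuads_iff hσ).1 hq).2 _ (Finset.mem_of_mem_insert_of_ne h2 (Ne.symm hne))
  omega

lemma card_closedQuads (hσ : IsEdgeStream G σ) :
    (closedQuads σ).card = 2 * fourCycleCount G := by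
  rw [Finset.card_eq_sum_card_fiberwise (f := Quad.edges) (t := fourCycles G)
    fun q hq => edges_mem_fourCycles hσ (closedQuads_subset_fullQuads σ hq), fourCycleCount,
    mul_comm, ← smul_eq_mul]
  refine Finset.sum_const_nat fun C hC => ?_
  obtain ⟨e, he, hmax⟩ := C.exists_max_image (fun e => σ.idxOf e) (by
    obtain ⟨a, b, c, d, -, -, -, -, -, -, rfl⟩ := mem_fourCycles.1 hC
    exact ⟨_, Finset.mem_insert_self _ _⟩)
  obtain ⟨a, b, c, d, ⟨h1, h2, h3, h4, hac, hbd⟩, hcd, hE⟩ :=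
    (mem_fourCycles.1 hC).exists_closing he
  have hfull : (a, b, c, d) ∈ fullQuads σ.toFinset :=
    (mem_fullQuads_iff_adj hσ).2 ⟨⟨hac, hbd⟩, h1, h2, h3, h4⟩
  have hq : (a, b, c, d) ∈ closedQuads σ := by
    refine (mem_closedQuads_iff hσ).2 ⟨hfull, fun x hx => ?_⟩
    have hxC : x ∈ C := by rw [← hE]; exact Finset.mem_insert_of_mem hx
    have hxσ : x ∈ σ := by
      have := (mem_fullQuads.1 hfull).2 (by rw [hE]; exact hxC)
      simpa using this
    have hne : x ≠ e := by
      have e1 := h1.ne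
      have e2 := h2.ne
      have e3 := h3.ne
      have e4 := h4.ne
      rw [← hcd]
      simp only [Quad.inner, Finset.mem_insert, Finset.mem_singleton] at hx
      rcases hx with rfl | rfl | rfl <;> rw [Ne, Sym2.eq_iff] <;> tauto
    refine lt_of_le_of_ne ?_ ?_
    · change _ ≤ σ.idxOf s(c, d)
      rw [hcd]; exact hmax x hxC
    · intro h
      change _ = σ.idxOf s(c, d) at h
      rw [hcd] at h
      exact hne ((List.idxOf_inj hxσ).1 h)
  have hfib : ((closedQuads σ).filter fun q => q.edges = C) =
      {(a, b, c, d), Quad.swap (a, b, c, d)} := by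
    ext r
    rw [Finset.mem_filter, Finset.mem_insert, Finset.mem_singleton]
    constructor
    · rintro ⟨hr, hrC⟩
      have hcl := closing_eq_of_edges_eq hσ hr hq (hrC.trans hE.symm)
      obtain ⟨a', b', c', d'⟩ := r
      have hr' := (mem_closedQuads.1 hr).1
      simp only [Quad.closing] at hcl
      rw [Sym2.eq_iff] at hcl
      rcases hcl with ⟨rfl, rfl⟩ | ⟨rfl, rfl⟩
      · obtain ⟨rfl, rfl⟩ := eq_of_edges_eq_of_adj h1 h2 h3 h4 hac hbd hr'.1 hr'.2
          (hrC.trans hE.symm)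
        exact Or.inl rfl
      · right
        have h := hrC.trans hE.symm
        rw [← Quad.edges_swap] at h
        obtain ⟨rfl, rfl⟩ := eq_of_edges_eq_of_adj h1 h2 h3 h4 hac hbd hr'.2 hr'.1 h
        rfl
    · rintro (rfl | rfl)
      · exact ⟨hq, hE⟩
      · exact ⟨swap_mem_closedQuads hq, (Quad.edges_swap _).trans hE⟩
  rw [hfib, Finset.card_pair]
  intro h
  exact h1.ne (congrArg Prod.fst h)

end Cycles

/-! ### Unbiasedness -/

section Unbiased

variable {n : ℕ} {G : SimpleGraph (Fin n)} {σ : List (Sym2 (Fin n))}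

lemma crowdedWeight_nonneg (θ : ℝ) (R : Finset (Fin n)) (σ : List (Sym2 (Fin n)))
    (q : Quad (Fin n)) : 0 ≤ crowdedWeight θ R σ q := by
  unfold crowdedWeight; split_ifs <;> norm_num

lemma crowdedWeight_le_one (θ : ℝ) (R : Finset (Fin n)) (σ : List (Sym2 (Fin n)))
    (q : Quad (Fin n)) : crowdedWeight θ R σ q ≤ 1 := by
  unfold crowdedWeight; split_ifs <;> norm_num

/-- Every 4-cycle has total weight one, whichever pairs look crowded: average over the two
quadruples that describe it. -/
lemma sum_weights (hσ : IsEdgeStream G σ) (θ : ℝ) (R : Finset (Fin n)) :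
    ∑ _q ∈ sparseQuads θ R σ, (1 / 2 : ℝ) + ∑ q ∈ crowdedQuads θ R σ, crowdedWeight θ R σ q =
      fourCycleCount G := by
  set f : Quad (Fin n) → ℝ := fun q =>
    (if ¬ Crowded θ R (arrivedBy σ q) q.1 q.2.2.1 ∧ ¬ Crowded θ R (arrivedBy σ q) q.2.1 q.2.2.2
      then 1 / 2 else 0) +
    (if Crowded θ R (arrivedBy σ q) q.1 q.2.2.1 then crowdedWeight θ R σ q else 0) with hf
  have h1 : ∑ _q ∈ sparseQuads θ R σ, (1 / 2 : ℝ) +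
      ∑ q ∈ crowdedQuads θ R σ, crowdedWeight θ R σ q = ∑ q ∈ closedQuads σ, f q := by
    rw [hf, Finset.sum_add_distrib, sparseQuads, crowdedQuads, Finset.sum_filter, Finset.sum_filter]
  have h2 : ∑ q ∈ closedQuads σ, f q = ∑ q ∈ closedQuads σ, f q.swap :=
    Finset.sum_nbij' Quad.swap Quad.swap (fun _ h => swap_mem_closedQuads h)
      (fun _ h => swap_mem_closedQuads h) (fun _ _ => rfl) (fun _ _ => rfl) (fun _ _ => rfl)
  have h3 : ∀ q, f q + f q.swap = 1 := by
    intro q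
    have hs : arrivedBy σ (q.2.1, q.1, q.2.2.2, q.2.2.1) = arrivedBy σ q := arrivedBy_swap σ q
    simp only [hf, crowdedWeight, Quad.swap, hs]
    by_cases ha : Crowded θ R (arrivedBy σ q) q.1 q.2.2.1 <;>
      by_cases hb : Crowded θ R (arrivedBy σ q) q.2.1 q.2.2.2 <;> simp [ha, hb] <;> norm_num
  have h4 : ∑ q ∈ closedQuads σ, f q + ∑ q ∈ closedQuads σ, f q.swap = 2 * fourCycleCount G := by
    rw [← Finset.sum_add_distrib, Finset.sum_congr rfl fun q _ => h3 q, Finset.sum_const,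
      card_closedQuads hσ]
    simp
  rw [h1]
  linarith

end Unbiased

/-! ### Good vertex samples -/

section Good

variable {V : Type*} [Fintype V] [DecidableEq V]

/-- The vertex sample `R` of rate `p` classifies correctly: a pair that looks crowded at the time of
closing has at least `θ / (4 p)` common neighbours then, any other pair at most `4 θ / p`. By
symmetry it is enough to look at the chosen pairs of the closed quadruples. -/
def GoodSample (p θ : ℝ) (σ : List (Sym2 V)) (R : Finset V) : Prop :=
  ∀ q ∈ closedQuads σ,
    (¬ Crowded θ R (arrivedBy σ q) q.1 q.2.2.1 →
      ((commonNbrs (arrivedBy σ q) q.1 q.2.2.1).card : ℝ) ≤ 4 * θ / p) ∧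
    (Crowded θ R (arrivedBy σ q) q.1 q.2.2.1 →
      θ / (4 * p) ≤ ((commonNbrs (arrivedBy σ q) q.1 q.2.2.1).card : ℝ))

lemma pmfProb_not_goodSample_le {n : ℕ} (p : unitInterval) (hp : 0 < (p : ℝ)) {θ : ℝ} (hθ : 0 ≤ θ)
    (σ : List (Sym2 (Fin n))) :
    pmfProb (randomSubset p (List.finRange n)) (fun R => ¬ GoodSample p θ σ R) ≤
      (n : ℝ) ^ 4 * (2 * Real.exp (-(θ / 2))) := by
  have hsub : ∀ D : Finset (Fin n), D ⊆ (List.finRange n).toFinset := fun D v _ => by simp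
  set bad : Quad (Fin n) → Finset (Fin n) → Prop := fun q R =>
    (4 * θ / p < ((commonNbrs (arrivedBy σ q) q.1 q.2.2.1).card : ℝ) ∧
      ((commonNbrs (arrivedBy σ q) q.1 q.2.2.1 ∩ R).card : ℝ) < θ) ∨
    (((commonNbrs (arrivedBy σ q) q.1 q.2.2.1).card : ℝ) < θ / (4 * p) ∧
      θ ≤ ((commonNbrs (arrivedBy σ q) q.1 q.2.2.1 ∩ R).card : ℝ)) with hbad
  refine (pmfProb_mono _ (t := fun R => ∃ q ∈ closedQuads σ, bad q R) fun R hR => ?_).trans ?_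
  · unfold GoodSample at hR
    push Not at hR
    obtain ⟨q, hq, h⟩ := hR
    refine ⟨q, hq, ?_⟩
    simp only [hbad]
    by_cases hc : Crowded θ R (arrivedBy σ q) q.1 q.2.2.1
    · refine Or.inr ⟨?_, hc⟩
      by_contra hlt
      have := h (fun h' => absurd hc h')
      exact absurd this.2 (by simpa using hlt)
    · refine Or.inl ⟨?_, lt_of_not_ge hc⟩
      by_contra hlt
      have := h (fun _ => le_of_not_gt hlt)
      exact hc this.1
  refine (pmfProb_exists_le _ _ _).trans ?_
  have hone : ∀ q ∈ closedQuads σ, pmfProb (randomSubset p (List.finRange n)) (bad q) ≤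
      2 * Real.exp (-(θ / 2)) := by
    intro q _
    have hexp := Real.exp_pos (-(θ / 2))
    set N := commonNbrs (arrivedBy σ q) q.1 q.2.2.1 with hN
    refine (pmfProb_or_le _ _ _).trans ?_
    have zero : ∀ s : Finset (Fin n) → Prop, (∀ R, ¬ s R) →
        pmfProb (randomSubset p (List.finRange n)) s ≤ Real.exp (-(θ / 2)) := by
      intro s hs
      refine le_trans ?_ hexp.le
      unfold pmfProb
      exact pmfMean_le_of_le _ fun R => by simp [hs R]
    have h1 : pmfProb (randomSubset p (List.finRange n)) (fun R => 4 * θ / p < (N.card : ℝ) ∧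
        ((N ∩ R).card : ℝ) < θ) ≤ Real.exp (-(θ / 2)) := by
      by_cases h : 4 * θ / p < (N.card : ℝ)
      · refine (pmfProb_mono _ fun R hR => hR.2).trans
          (pmfProb_randomSubset_lt p (List.nodup_finRange n) (hsub N) ?_ hθ)
        rw [div_lt_iff₀ hp] at h
        linarith
      · exact zero _ fun R hR => h hR.1
    have h2 : pmfProb (randomSubset p (List.finRange n)) (fun R => (N.card : ℝ) < θ / (4 * p) ∧
        θ ≤ ((N ∩ R).card : ℝ)) ≤ Real.exp (-(θ / 2)) := by
      by_cases h : (N.card : ℝ) < θ / (4 * p)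
      · refine (pmfProb_mono _ fun R hR => hR.2).trans
          (pmfProb_randomSubset_ge p (List.nodup_finRange n) (hsub N) ?_)
        rw [lt_div_iff₀ (by positivity)] at h
        linarith
      · exact zero _ fun R hR => h hR.1
    linarith
  refine (Finset.sum_le_card_nsmul _ _ _ hone).trans ?_
  rw [nsmul_eq_mul]
  refine mul_le_mul_of_nonneg_right ?_ (by positivity)
  have h : (closedQuads σ).card ≤ n ^ 4 := by
    refine (Finset.card_le_univ _).trans_eq ?_
    simp only [Quad, Fintype.card_prod, Fintype.card_fin]
    ring
  exact_mod_cast h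

end Good

/-! ### Overlaps of sparse quadruples -/

section Sparse

variable {V : Type*} [Fintype V] [DecidableEq V] {G : SimpleGraph V} {σ : List (Sym2 V)}

lemma commonNbrs_comm (F : Finset (Sym2 V)) (a c : V) : commonNbrs F a c = commonNbrs F c a := by
  ext v
  simp only [commonNbrs, Finset.mem_filter, Finset.mem_univ, true_and,
    Sym2.eq_swap (a := a) (b := v), Sym2.eq_swap (a := v) (b := c)]
  tauto

lemma commonNbrs_mono {F F' : Finset (Sym2 V)} (h : F ⊆ F') (a c : V) :
    commonNbrs F a c ⊆ commonNbrs F' a c := by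
  intro v hv
  simp only [commonNbrs, Finset.mem_filter, Finset.mem_univ, true_and] at hv ⊢
  exact ⟨h hv.1, h hv.2⟩

lemma edges_subset_arrivedBy (hσ : IsEdgeStream G σ) {q : Quad V} (hq : q ∈ closedQuads σ) :
    q.edges ⊆ arrivedBy σ q := by
  intro e he
  have hfull := closedQuads_subset_fullQuads σ hq
  have heσ : e ∈ σ := by simpa using (mem_fullQuads.1 hfull).2 he
  rw [arrivedBy, List.mem_toFinset, mem_take_iff_idxOf_lt_of_nodup hσ.1]
  refine ⟨heσ, Nat.lt_succ_of_le ?_⟩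
  rw [Quad.edges, Finset.mem_insert] at he
  rcases he with rfl | he
  · exact le_rfl
  · exact (((mem_closedQuads_iff hσ).1 hq).2 e he).le

lemma quad_distinct (hσ : IsEdgeStream G σ) {a b c d : V} (hq : (a, b, c, d) ∈ closedQuads σ) :
    a ≠ b ∧ b ≠ c ∧ c ≠ d ∧ a ≠ d ∧ a ≠ c ∧ b ≠ d := by
  have h := (mem_fullQuads_iff_adj hσ).1 (closedQuads_subset_fullQuads σ hq)
  exact ⟨h.2.1.ne, h.2.2.1.ne, h.2.2.2.1.ne, h.2.2.2.2.ne, h.1.1, h.1.2⟩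

lemma card_filter_edge_le (hσ : IsEdgeStream G σ) {J : Finset (Quad V)} (hJ : J ⊆ closedQuads σ)
    (e : Sym2 V) : (J.filter fun k => e ∈ k.edges).card ≤ 256 * edgeFourCycleCount G e :=
  (Finset.card_le_card (Finset.filter_subset_filter _
    (hJ.trans (closedQuads_subset_fullQuads σ)))).trans (card_fullQuads_filter_le hσ e)

/-- Where a path `u - v - w` sits among the inner edges of a closed quadruple: the fourth vertex of
the cycle is a common neighbour of `u` and `w` when the cycle is closed, and the sample does not see
`u`, `w` as crowded. -/
lemma exists_fourth_vertex (hσ : IsEdgeStream G σ) {p θ : ℝ} {R : Finset V}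
    (hR : GoodSample p θ σ R) {u v w : V} (huw : u ≠ w) {k : Quad V}
    (hk : k ∈ sparseQuads θ R σ) (h1 : s(u, v) ∈ k.inner) (h2 : s(v, w) ∈ k.inner) :
    ((commonNbrs (arrivedBy σ k) u w).card : ℝ) ≤ 4 * θ / p ∧
      ∃ z ∈ commonNbrs (arrivedBy σ k) u w, k.verts ⊆ {u, v, w, z} := by
  obtain ⟨a, b, c, d⟩ := k
  rw [sparseQuads, Finset.mem_filter] at hk
  obtain ⟨hk, hac, hbd⟩ := hk
  have hdist := quad_distinct hσ hk
  obtain ⟨e1, e2, e3, e4, e5, e6⟩ := hdist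
  have hE := edges_subset_arrivedBy hσ hk
  have hcard1 : ((commonNbrs (arrivedBy σ (a, b, c, d)) a c).card : ℝ) ≤ 4 * θ / p :=
    (hR _ hk).1 hac
  have hcard2 : ((commonNbrs (arrivedBy σ (a, b, c, d)) b d).card : ℝ) ≤ 4 * θ / p := by
    have := (hR _ (swap_mem_closedQuads hk)).1
    rw [arrivedBy_swap] at this
    exact this hbd
  simp only [Quad.edges, Quad.closing, Quad.inner, Finset.insert_subset_iff,
    Finset.singleton_subset_iff] at hE
  obtain ⟨f1, f2, f3, f4⟩ := hE
  have hd : d ∈ commonNbrs (arrivedBy σ (a, b, c, d)) a c := by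
    simp only [commonNbrs, Finset.mem_filter, Finset.mem_univ, true_and]
    exact ⟨f4, by rwa [Sym2.eq_swap]⟩
  have hc : c ∈ commonNbrs (arrivedBy σ (a, b, c, d)) b d := by
    simp only [commonNbrs, Finset.mem_filter, Finset.mem_univ, true_and]
    exact ⟨f3, f1⟩
  have hcases : (v = b ∧ (u = a ∧ w = c ∨ u = c ∧ w = a)) ∨
      (v = a ∧ (u = b ∧ w = d ∨ u = d ∧ w = b)) := by
    simp only [Quad.inner, Finset.mem_insert, Finset.mem_singleton, Sym2.eq_iff] at h1 h2
    grind
  rcases hcases with ⟨rfl, ⟨rfl, rfl⟩ | ⟨rfl, rfl⟩⟩ | ⟨rfl, ⟨rfl, rfl⟩ | ⟨rfl, rfl⟩⟩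
  · refine ⟨hcard1, d, hd, ?_⟩
    intro x; simp only [Quad.verts, Finset.mem_insert, Finset.mem_singleton]; tauto
  · rw [commonNbrs_comm]
    refine ⟨hcard1, d, hd, ?_⟩
    intro x; simp only [Quad.verts, Finset.mem_insert, Finset.mem_singleton]; tauto
  · refine ⟨hcard2, c, hc, ?_⟩
    intro x; simp only [Quad.verts, Finset.mem_insert, Finset.mem_singleton]; tauto
  · rw [commonNbrs_comm]
    refine ⟨hcard2, c, hc, ?_⟩
    intro x; simp only [Quad.verts, Finset.mem_insert, Finset.mem_singleton]; tauto

/-- Few sparse quadruples contain a given path with two edges among their inner edges: at the time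
when the last one of them is closed, all their fourth vertices are common neighbours of the ends of
the path. -/
lemma card_filter_path_le (hσ : IsEdgeStream G σ) {p θ : ℝ} (hp : 0 < p) (hθ : 0 ≤ θ)
    {R : Finset V} (hR : GoodSample p θ σ R) {u v w : V} (huw : u ≠ w) :
    (((sparseQuads θ R σ).filter fun k => s(u, v) ∈ k.inner ∧ s(v, w) ∈ k.inner).card : ℝ) ≤
      256 * (4 * θ / p) := by
  set A := (sparseQuads θ R σ).filter fun k => s(u, v) ∈ k.inner ∧ s(v, w) ∈ k.inner with hA
  rcases A.eq_empty_or_nonempty with h | hne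
  · rw [h, Finset.card_empty, Nat.cast_zero]; positivity
  obtain ⟨k₀, hk₀, hmax⟩ := A.exists_max_image (fun k => σ.idxOf k.closing) hne
  have hk₀' := Finset.mem_filter.1 hk₀
  have hbound := (exists_fourth_vertex hσ hR huw hk₀'.1 hk₀'.2.1 hk₀'.2.2).1
  have hsub : A ⊆ (commonNbrs (arrivedBy σ k₀) u w).biUnion fun z =>
      A.filter fun k => k.verts ⊆ {u, v, w, z} := by
    intro k hk
    have hk' := Finset.mem_filter.1 hk
    obtain ⟨-, z, hz, hkz⟩ := exists_fourth_vertex hσ hR huw hk'.1 hk'.2.1 hk'.2.2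
    rw [Finset.mem_biUnion]
    refine ⟨z, commonNbrs_mono ?_ u w hz, Finset.mem_filter.2 ⟨hk, hkz⟩⟩
    intro x hx
    rw [arrivedBy, List.mem_toFinset, mem_take_iff_idxOf_lt_of_nodup hσ.1] at hx ⊢
    exact ⟨hx.1, hx.2.trans_le (Nat.succ_le_succ (hmax k hk))⟩
  have hcard : A.card ≤ (commonNbrs (arrivedBy σ k₀) u w).card * 256 := by
    refine (Finset.card_le_card hsub).trans (Finset.card_biUnion_le_card_mul _ _ _ fun z _ => ?_)
    exact card_quads_le Finset.card_le_four fun k hk => (Finset.mem_filter.1 hk).2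
  have hcard' : (A.card : ℝ) ≤ (commonNbrs (arrivedBy σ k₀) u w).card * 256 := by
    exact_mod_cast hcard
  linarith

/-- The overlap condition for the estimator of the sparse quadruples. -/
lemma sparse_overlap_le (hσ : IsEdgeStream G σ) {p θ : ℝ} (hp : 0 < p) (hp1 : p ≤ 1) (hθ : 0 ≤ θ)
    {R : Finset V} (hR : GoodSample p θ σ R) {O : Sym2 V → Bool} {τ : ℝ}
    (hO : IsHeavyEdgeOracle G τ O) {β : ℝ}
    (h1 : (p⁻¹ - 1) * (256 * τ) ≤ β) (h2 : (p⁻¹ - 1) ^ 2 * 256 ≤ β) (h3 : (p⁻¹ - 1) ^ 3 * 256 ≤ β)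
    (h4 : (p⁻¹ - 1) ^ 2 * (256 * (4 * θ / p)) ≤ β) :
    ∀ j ∈ sparseQuads θ R σ, ∀ D ⊆ lightInner O j, D.Nonempty →
      (p⁻¹ - 1) ^ D.card *
        (((sparseQuads θ R σ).filter fun k => D ⊆ lightInner O k).card : ℝ) ≤ β := by
  rintro ⟨a, b, c, d⟩ hj D hD hne
  have hx : 0 ≤ p⁻¹ - 1 := sub_nonneg.2 ((one_le_inv₀ hp).2 hp1)
  have hjc : (a, b, c, d) ∈ closedQuads σ := Finset.filter_subset _ _ hj
  obtain ⟨e1, e2, e3, e4, e5, e6⟩ := quad_distinct hσ hjc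
  set J := sparseQuads θ R σ with hJ
  have hDin : D ⊆ {s(a, b), s(b, c), s(a, d)} := hD.trans (Finset.filter_subset _ _)
  have hmono : ∀ P : Quad V → Prop, ∀ [DecidablePred P],
      (∀ k, D ⊆ lightInner O k → P k) →
      ((J.filter fun k => D ⊆ lightInner O k).card : ℝ) ≤ ((J.filter P).card : ℝ) := by
    intro P _ hP
    exact_mod_cast Finset.card_le_card
      (Finset.monotone_filter_right J fun k _ hk => hP k hk)
  have hin : ∀ k, D ⊆ lightInner O k → D ⊆ k.inner := fun k hk =>
    hk.trans (Finset.filter_subset _ _)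
  have n1 : s(a, b) ≠ s(b, c) := by rw [Ne, Sym2.eq_iff]; tauto
  have n2 : s(a, b) ≠ s(a, d) := by rw [Ne, Sym2.eq_iff]; tauto
  have n3 : s(b, c) ≠ s(a, d) := by rw [Ne, Sym2.eq_iff]; tauto
  by_cases hopp : s(b, c) ∈ D ∧ s(a, d) ∈ D
  · have hc : ((J.filter fun k => D ⊆ lightInner O k).card : ℝ) ≤ 256 :=
      (hmono (fun k => s(b, c) ∈ k.inner ∧ s(a, d) ∈ k.inner) fun k hk =>
        ⟨hin k hk hopp.1, hin k hk hopp.2⟩).trans (by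
          exact_mod_cast card_filter_opposite_le e1 e5 e4 e2 e6 e3 J)
    have hlow : 2 ≤ D.card := by
      rw [← Finset.card_pair n3]
      exact Finset.card_le_card (Finset.insert_subset hopp.1 (by simpa using hopp.2))
    have hupp : D.card ≤ 3 := (Finset.card_le_card hDin).trans Finset.card_le_three
    have hD23 : D.card = 2 ∨ D.card = 3 := by omega
    refine (mul_le_mul_of_nonneg_left hc (pow_nonneg hx _)).trans ?_
    rcases hD23 with h | h <;> rw [h] <;> assumption
  by_cases hsingle : D.card = 1
  · obtain ⟨e, rfl⟩ := Finset.card_eq_one.1 hsingle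
    rw [hsingle, pow_one]
    refine le_trans (mul_le_mul_of_nonneg_left ?_ hx) h1
    refine (hmono (fun k => e ∈ k.edges) fun k hk =>
      Finset.mem_insert_of_mem (hin k hk (Finset.mem_singleton_self e))).trans ?_
    have he := hD (Finset.mem_singleton_self e)
    rw [lightInner, Finset.mem_filter] at he
    have heG : e ∈ G.edgeSet := by
      rw [← hσ.2, ← List.mem_toFinset]
      exact (mem_fullQuads.1 (closedQuads_subset_fullQuads σ hjc)).2
        (Finset.mem_insert_of_mem he.1)
    have hlight : (edgeFourCycleCount G e : ℝ) < τ := by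
      by_contra hge
      have := (hO e heG).2 (le_of_not_gt hge)
      rw [he.2] at this
      exact absurd this (by simp)
    have hcard : ((J.filter fun k => e ∈ k.edges).card : ℝ) ≤ 256 * edgeFourCycleCount G e := by
      exact_mod_cast card_filter_edge_le hσ (Finset.filter_subset _ _) e
    linarith
  · have hpath : (s(a, b) ∈ D ∧ s(b, c) ∈ D ∧ s(a, d) ∉ D) ∨
        (s(a, b) ∈ D ∧ s(a, d) ∈ D ∧ s(b, c) ∉ D) := by
      by_contra hcon
      apply hsingle
      rw [Finset.card_eq_one]
      obtain ⟨e, he⟩ := hne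
      refine ⟨e, Finset.eq_singleton_iff_unique_mem.2 ⟨he, fun x hx => ?_⟩⟩
      have hx' := hDin hx
      have he' := hDin he
      simp only [Finset.mem_insert, Finset.mem_singleton] at hx' he'
      rcases hx' with rfl | rfl | rfl <;> rcases he' with rfl | rfl | rfl <;> tauto
    have hcard : D.card = 2 := by
      rcases hpath with h | h
      · rw [show D = {s(a, b), s(b, c)} from ?_, Finset.card_pair n1]
        ext x
        constructor
        · intro hx
          have := hDin hx
          simp only [Finset.mem_insert, Finset.mem_singleton] at this ⊢
          rcases this with rfl | rfl | rfl <;> tauto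
        · simp only [Finset.mem_insert, Finset.mem_singleton]
          rintro (rfl | rfl) <;> tauto
      · rw [show D = {s(a, b), s(a, d)} from ?_, Finset.card_pair n2]
        ext x
        constructor
        · intro hx
          have := hDin hx
          simp only [Finset.mem_insert, Finset.mem_singleton] at this ⊢
          rcases this with rfl | rfl | rfl <;> tauto
        · simp only [Finset.mem_insert, Finset.mem_singleton]
          rintro (rfl | rfl) <;> tauto
    rw [hcard]
    refine le_trans (mul_le_mul_of_nonneg_left ?_ (pow_nonneg hx 2)) h4
    rcases hpath with h | h
    · exact (hmono (fun k => s(a, b) ∈ k.inner ∧ s(b, c) ∈ k.inner) fun k hk =>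
        ⟨hin k hk h.1, hin k hk h.2.1⟩).trans (card_filter_path_le hσ hp hθ hR e5)
    · refine (hmono (fun k => s(b, a) ∈ k.inner ∧ s(a, d) ∈ k.inner) fun k hk =>
        ⟨?_, hin k hk h.2.1⟩).trans (card_filter_path_le hσ hp hθ hR e6)
      rw [Sym2.eq_swap]
      exact hin k hk h.1

end Sparse

/-! ### Overlaps of crowded quadruples -/

section CrowdedPairs

variable {V : Type*} [Fintype V] [DecidableEq V] {G : SimpleGraph V} {σ : List (Sym2 V)}

/-- The ordered pairs with at least `X`, and at least two, common neighbours in the whole graph. -/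
noncomputable def richPairs (X : ℝ) (F : Finset (Sym2 V)) : Finset (V × V) :=
  Finset.univ.filter fun x => x.1 ≠ x.2 ∧ X ≤ ((commonNbrs F x.1 x.2).card : ℝ) ∧
    2 ≤ (commonNbrs F x.1 x.2).card

/-- Two common neighbours of a pair form a 4-cycle with it. -/
lemma sum_card_commonNbrs_sq_le (hσ : IsEdgeStream G σ) (X : ℝ) :
    ∑ x ∈ richPairs X σ.toFinset, (commonNbrs σ.toFinset x.1 x.2).card ^ 2 ≤
      512 * fourCycleCount G := by
  have h1 : ∑ x ∈ richPairs X σ.toFinset, (commonNbrs σ.toFinset x.1 x.2).offDiag.card ≤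
      (fullQuads σ.toFinset).card := by
    rw [← Finset.card_sigma]
    refine Finset.card_le_card_of_injOn
      (fun y : (_ : V × V) × (V × V) => (y.1.1, y.2.1, y.1.2, y.2.2)) ?_ ?_
    · rintro ⟨⟨a, c⟩, ⟨b, d⟩⟩ h
      obtain ⟨h1, h2⟩ := Finset.mem_sigma.1 (Finset.mem_coe.1 h)
      have hne : a ≠ c := (Finset.mem_filter.1 h1).2.1
      simp only [Finset.mem_offDiag, commonNbrs, Finset.mem_filter, Finset.mem_univ, true_and,
        hσ.adj_iff] at h2
      rw [Finset.mem_coe, mem_fullQuads_iff_adj hσ]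
      exact ⟨⟨hne, h2.2.2⟩, h2.1.1, h2.1.2, h2.2.1.2.symm, h2.2.1.1⟩
    · rintro ⟨⟨a, c⟩, ⟨b, d⟩⟩ - ⟨⟨a', c'⟩, ⟨b', d'⟩⟩ - h
      simp only [Prod.mk.injEq] at h
      obtain ⟨rfl, rfl, rfl, rfl⟩ := h
      rfl
  have h2 : ∀ x ∈ richPairs X σ.toFinset, (commonNbrs σ.toFinset x.1 x.2).card ^ 2 ≤
      2 * (commonNbrs σ.toFinset x.1 x.2).offDiag.card := by
    intro x hx
    have hx2 := (Finset.mem_filter.1 hx).2.2.2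
    rw [Finset.offDiag_card]
    generalize (commonNbrs σ.toFinset x.1 x.2).card = m at hx2
    have : m ≤ m * m := by nlinarith
    zify [this]
    zify at hx2
    nlinarith
  refine (Finset.sum_le_sum h2).trans ?_
  rw [← Finset.mul_sum]
  have h3 := card_fullQuads_le hσ
  omega

/-- The common neighbours of rich pairs, summed over these pairs, number `O(T / X)`. -/
lemma mul_sum_card_commonNbrs_le (hσ : IsEdgeStream G σ) (X : ℝ) :
    X * ∑ x ∈ richPairs X σ.toFinset, ((commonNbrs σ.toFinset x.1 x.2).card : ℝ) ≤
      512 * fourCycleCount G := by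
  have h : (∑ x ∈ richPairs X σ.toFinset, ((commonNbrs σ.toFinset x.1 x.2).card : ℝ) ^ 2) ≤
      512 * fourCycleCount G := by
    exact_mod_cast sum_card_commonNbrs_sq_le hσ X
  refine le_trans ?_ h
  rw [Finset.mul_sum]
  refine Finset.sum_le_sum fun x hx => ?_
  rw [sq]
  exact mul_le_mul_of_nonneg_right (Finset.mem_filter.1 hx).2.2.1 (Nat.cast_nonneg _)

lemma sq_mul_card_richPairs_le (hσ : IsEdgeStream G σ) {X : ℝ} (hX : 0 ≤ X) :
    X ^ 2 * ((richPairs X σ.toFinset).card : ℝ) ≤ 512 * fourCycleCount G := by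
  refine le_trans ?_ (mul_sum_card_commonNbrs_le hσ X)
  rw [sq, mul_assoc]
  refine mul_le_mul_of_nonneg_left ?_ hX
  rw [mul_comm, ← nsmul_eq_mul]
  exact Finset.card_nsmul_le_sum _ _ _ fun x hx => (Finset.mem_filter.1 hx).2.2.1

lemma mem_of_mem_crowdedQuads (hσ : IsEdgeStream G σ) {p θ : ℝ} {R : Finset V}
    (hR : GoodSample p θ σ R) {a b c d : V} (hk : (a, b, c, d) ∈ crowdedQuads θ R σ) :
    (a, c) ∈ richPairs (θ / (4 * p)) σ.toFinset ∧ b ∈ commonNbrs σ.toFinset a c ∧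
      d ∈ commonNbrs σ.toFinset a c ∧ b ≠ d := by
  rw [crowdedQuads, Finset.mem_filter] at hk
  have hfull := (mem_fullQuads_iff_adj hσ).1 (closedQuads_subset_fullQuads σ hk.1)
  have hb : b ∈ commonNbrs σ.toFinset a c := by
    simp only [commonNbrs, Finset.mem_filter, Finset.mem_univ, true_and, hσ.adj_iff]
    exact ⟨hfull.2.1, hfull.2.2.1⟩
  have hd : d ∈ commonNbrs σ.toFinset a c := by
    simp only [commonNbrs, Finset.mem_filter, Finset.mem_univ, true_and, hσ.adj_iff]
    exact ⟨hfull.2.2.2.2, hfull.2.2.2.1.symm⟩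
  refine ⟨?_, hb, hd, hfull.1.2⟩
  simp only [richPairs, Finset.mem_filter, Finset.mem_univ, true_and]
  refine ⟨hfull.1.1, ((hR _ hk.1).2 hk.2).trans ?_, ?_⟩
  · exact_mod_cast Finset.card_le_card (commonNbrs_mono (arrivedBy_subset σ _) a c)
  · rw [← Finset.card_pair hfull.1.2]
    exact Finset.card_le_card (Finset.insert_subset hb (by simpa using hd))

/-- A crowded quadruple through `v` is determined by its crowded pair and by the partner of `v`, a
common neighbour of that pair. -/
lemma card_crowdedQuads_vertex_le (hσ : IsEdgeStream G σ) {p θ : ℝ} {R : Finset V}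
    (hR : GoodSample p θ σ R) (v : V) :
    ((crowdedQuads θ R σ).filter fun k => v = k.2.1 ∨ v = k.2.2.2).card ≤
      2 * ∑ x ∈ richPairs (θ / (4 * p)) σ.toFinset, (commonNbrs σ.toFinset x.1 x.2).card := by
  rw [Finset.filter_or, two_mul, ← Finset.card_sigma]
  refine (Finset.card_union_le _ _).trans (add_le_add ?_ ?_)
  · refine Finset.card_le_card_of_injOn
      (fun k : Quad V => (⟨(k.1, k.2.2.1), k.2.2.2⟩ : (_ : V × V) × V)) ?_ ?_
    · rintro ⟨a, b, c, d⟩ h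
      rw [Finset.mem_coe, Finset.mem_filter] at h
      have := mem_of_mem_crowdedQuads hσ hR h.1
      rw [Finset.mem_coe, Finset.mem_sigma]
      exact ⟨this.1, this.2.2.1⟩
    · rintro ⟨a, b, c, d⟩ h ⟨a', b', c', d'⟩ h' heq
      rw [Finset.mem_coe, Finset.mem_filter] at h h'
      simp only [Sigma.mk.injEq, Prod.mk.injEq, heq_eq_eq] at heq
      obtain ⟨⟨rfl, rfl⟩, rfl⟩ := heq
      obtain rfl : b = b' := h.2.symm.trans h'.2
      rfl
  · refine Finset.card_le_card_of_injOn
      (fun k : Quad V => (⟨(k.1, k.2.2.1), k.2.1⟩ : (_ : V × V) × V)) ?_ ?_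
    · rintro ⟨a, b, c, d⟩ h
      rw [Finset.mem_coe, Finset.mem_filter] at h
      have := mem_of_mem_crowdedQuads hσ hR h.1
      rw [Finset.mem_coe, Finset.mem_sigma]
      exact ⟨this.1, this.2.1⟩
    · rintro ⟨a, b, c, d⟩ h ⟨a', b', c', d'⟩ h' heq
      rw [Finset.mem_coe, Finset.mem_filter] at h h'
      simp only [Sigma.mk.injEq, Prod.mk.injEq, heq_eq_eq] at heq
      obtain ⟨⟨rfl, rfl⟩, rfl⟩ := heq
      obtain rfl : d = d' := h.2.symm.trans h'.2
      rfl

lemma card_crowdedQuads_pair_le (hσ : IsEdgeStream G σ) {p θ : ℝ} {R : Finset V}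
    (hR : GoodSample p θ σ R) (v w : V) :
    ((crowdedQuads θ R σ).filter fun k => (v = k.2.1 ∧ w = k.2.2.2) ∨
      (v = k.2.2.2 ∧ w = k.2.1)).card ≤ 2 * (richPairs (θ / (4 * p)) σ.toFinset).card := by
  rw [Finset.filter_or, two_mul]
  refine (Finset.card_union_le _ _).trans (add_le_add ?_ ?_)
  all_goals
    refine Finset.card_le_card_of_injOn (fun k : Quad V => (k.1, k.2.2.1)) ?_ ?_
    · rintro ⟨a, b, c, d⟩ h
      rw [Finset.mem_coe, Finset.mem_filter] at h
      exact (mem_of_mem_crowdedQuads hσ hR h.1).1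
    · rintro ⟨a, b, c, d⟩ h ⟨a', b', c', d'⟩ h' heq
      rw [Finset.mem_coe, Finset.mem_filter] at h h'
      simp only [Prod.mk.injEq] at heq
      obtain ⟨rfl, rfl⟩ := heq
      obtain ⟨-, h1, h2⟩ := h
      obtain ⟨-, h3, h4⟩ := h'
      dsimp only at h1 h2 h3 h4
      subst h1 h2 h3 h4
      rfl

/-- The overlap condition for the estimator of the crowded quadruples. -/
lemma crowded_overlap_le (hσ : IsEdgeStream G σ) {p θ : ℝ} (hp : 0 < p) (hp1 : p ≤ 1) (hθ : 1 ≤ θ)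
    {R : Finset V} (hR : GoodSample p θ σ R) {β : ℝ} (hβ : 16384 * fourCycleCount G / θ ≤ β) :
    ∀ j ∈ crowdedQuads θ R σ, ∀ D ⊆ ({j.2.1, j.2.2.2} : Finset V), D.Nonempty →
      (p⁻¹ - 1) ^ D.card * (((crowdedQuads θ R σ).filter fun k =>
        D ⊆ ({k.2.1, k.2.2.2} : Finset V)).card : ℝ) ≤ β := by
  rintro ⟨a, b, c, d⟩ hj D hD hne
  have hbd := (mem_of_mem_crowdedQuads hσ hR hj).2.2.2
  have hx : 0 ≤ p⁻¹ - 1 := sub_nonneg.2 ((one_le_inv₀ hp).2 hp1)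
  have hθ0 : 0 < θ := by linarith
  set X := θ / (4 * p) with hX
  have hX0 : 0 < X := by positivity
  have hxX : (p⁻¹ - 1) ≤ 4 * X / θ := by
    rw [hX]
    have : 4 * (θ / (4 * p)) / θ = p⁻¹ := by field_simp
    rw [this]
    linarith
  set T : ℝ := (fourCycleCount G : ℝ) with hT
  have hT0 : 0 ≤ T := Nat.cast_nonneg _
  have hDcard : D.card ≤ 2 := (Finset.card_le_card hD).trans Finset.card_le_two
  have hDpos := hne.card_pos
  have hD12 : D.card = 1 ∨ D.card = 2 := by omega
  refine le_trans ?_ hβ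
  rcases hD12 with h | h
  · obtain ⟨v, rfl⟩ := Finset.card_eq_one.1 h
    rw [h, pow_one]
    have h1 : (((crowdedQuads θ R σ).filter fun k =>
        {v} ⊆ ({k.2.1, k.2.2.2} : Finset V)).card : ℝ) ≤
        2 * ∑ x ∈ richPairs X σ.toFinset, ((commonNbrs σ.toFinset x.1 x.2).card : ℝ) := by
      have := card_crowdedQuads_vertex_le hσ hR v
      simp only [Finset.singleton_subset_iff, Finset.mem_insert, Finset.mem_singleton]
      exact_mod_cast this
    have h2 := mul_sum_card_commonNbrs_le hσ X
    rw [← hT] at h2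
    calc _ ≤ (4 * X / θ) * (2 * ∑ x ∈ richPairs X σ.toFinset,
          ((commonNbrs σ.toFinset x.1 x.2).card : ℝ)) :=
          mul_le_mul hxX h1 (Nat.cast_nonneg _) (by positivity)
      _ = 8 * (X * ∑ x ∈ richPairs X σ.toFinset,
          ((commonNbrs σ.toFinset x.1 x.2).card : ℝ)) / θ := by ring
      _ ≤ 8 * (512 * T) / θ := by gcongr
      _ ≤ 16384 * T / θ := by gcongr ?_ / θ; linarith
  · rw [h]
    have hDeq : D = {b, d} :=
      Finset.eq_of_subset_of_card_le hD (by rw [h]; exact Finset.card_le_two)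
    subst hDeq
    have h1 : (((crowdedQuads θ R σ).filter fun k =>
        {b, d} ⊆ ({k.2.1, k.2.2.2} : Finset V)).card : ℝ) ≤
        2 * ((richPairs X σ.toFinset).card : ℝ) := by
      have h2 := card_crowdedQuads_pair_le hσ hR b d
      have h3 : ((crowdedQuads θ R σ).filter fun k => {b, d} ⊆ ({k.2.1, k.2.2.2} : Finset V)).card ≤
          ((crowdedQuads θ R σ).filter fun k => (b = k.2.1 ∧ d = k.2.2.2) ∨
            (b = k.2.2.2 ∧ d = k.2.1)).card := by
        refine Finset.card_le_card (Finset.monotone_filter_right _ fun k _ hk => ?_)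
        simp only [Finset.insert_subset_iff, Finset.singleton_subset_iff, Finset.mem_insert,
          Finset.mem_singleton] at hk
        grind
      exact_mod_cast h3.trans h2
    have h2 := sq_mul_card_richPairs_le hσ hX0.le
    rw [← hT] at h2
    calc _ ≤ (4 * X / θ) ^ 2 * (2 * ((richPairs X σ.toFinset).card : ℝ)) :=
          mul_le_mul (pow_le_pow_left₀ hx hxX 2) h1 (Nat.cast_nonneg _) (by positivity)
      _ = 32 * (X ^ 2 * ((richPairs X σ.toFinset).card : ℝ)) / θ ^ 2 := by ring
      _ ≤ 32 * (512 * T) / θ ^ 2 := by gcongr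
      _ ≤ 32 * (512 * T) / θ := by gcongr; nlinarith
      _ = 16384 * T / θ := by ring

end CrowdedPairs

/-! ### Accuracy -/

section Accuracy

variable {n : ℕ} {G : SimpleGraph (Fin n)} {σ : List (Sym2 (Fin n))}

/-- Both estimators are unbiased given the first vertex sample, and if that sample is good, then
Chebyshev's inequality applies to them. -/
lemma pmfProb_output_error_le (hσ : IsEdgeStream G σ) (p : unitInterval) (hp : 0 < (p : ℝ)) {θ : ℝ}
    (hθ : 1 ≤ θ) (O : Sym2 (Fin n) → Bool) {β ε : ℝ} (hβ0 : 0 ≤ β) (hε : 0 < ε)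
    (hT : 1 ≤ fourCycleCount G)
    (hsparse : ∀ R, GoodSample p θ σ R → ∀ j ∈ sparseQuads θ R σ, ∀ D ⊆ lightInner O j,
      D.Nonempty → ((p : ℝ)⁻¹ - 1) ^ D.card *
        (((sparseQuads θ R σ).filter fun k => D ⊆ lightInner O k).card : ℝ) ≤ β)
    (hβ : 16384 * fourCycleCount G / θ ≤ β) :
    pmfProb (samples p σ) (fun ω => ε * fourCycleCount G <
      |(fourCycleAlgorithm n p θ).output (Memory.after θ O σ ω) - fourCycleCount G|) ≤
      (n : ℝ) ^ 4 * (2 * Real.exp (-(θ / 2))) + 64 * β / (ε ^ 2 * fourCycleCount G) := by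
  set T : ℝ := (fourCycleCount G : ℝ) with hTdef
  have hT1 : (1 : ℝ) ≤ T := by rw [hTdef]; exact_mod_cast hT
  have hT0 : 0 < T := by linarith
  set Y := fun R => htEstimator p (sparseQuads θ R σ) (lightInner O) (fun _ => (1 / 2 : ℝ)) with hY
  set Z := fun R => htEstimator p (crowdedQuads θ R σ) (fun q => {q.2.1, q.2.2.2})
    (crowdedWeight θ R σ) with hZ
  set y := fun R => ∑ _q ∈ sparseQuads θ R σ, (1 / 2 : ℝ) with hy
  set z := fun R => ∑ q ∈ crowdedQuads θ R σ, crowdedWeight θ R σ q with hz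
  have hyz : ∀ R, y R + z R = T := sum_weights hσ θ
  have hy0 : ∀ R, 0 ≤ y R := fun R => Finset.sum_nonneg fun _ _ => by norm_num
  have hz0 : ∀ R, 0 ≤ z R := fun R => Finset.sum_nonneg fun q _ => crowdedWeight_nonneg θ R σ q
  have hdev : 0 < ε * T / 2 := by positivity
  have hconst : 8 * β * T / (ε * T / 2) ^ 2 = 32 * β / (ε ^ 2 * T) := by
    field_simp
    ring
  -- Chebyshev for the two estimators, given a good first sample
  have hYdev : ∀ R, GoodSample p θ σ R →
      pmfProb (randomSubset p σ) (fun S => ε * T / 2 < |Y R S - y R|) ≤ 32 * β / (ε ^ 2 * T) := by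
    intro R hR
    refine (pmfProb_lt_abs_sub_le _ _ _ hdev).trans ?_
    rw [← hconst]
    refine div_le_div_of_nonneg_right ?_ (by positivity)
    refine (pmfMean_htEstimator_sub_sq_le p hp.ne' hσ.1 (sparseQuads θ R σ) (fun j hj => ?_)
      (fun j _ => (Finset.card_filter_le _ _).trans Finset.card_le_three) (fun _ _ => by norm_num)
      (fun _ _ => by norm_num) hβ0 (hsparse R hR)).trans ?_
    · refine (Finset.filter_subset _ _).trans fun e he => ?_
      exact (mem_fullQuads.1 (closedQuads_subset_fullQuads σ (Finset.filter_subset _ _ hj))).2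
        (Finset.mem_insert_of_mem he)
    · refine mul_le_mul_of_nonneg_left ?_ (by positivity)
      have := hyz R
      have := hz0 R
      change y R ≤ T
      linarith
  have hZdev : ∀ R, GoodSample p θ σ R →
      pmfProb (randomSubset p (List.finRange n)) (fun S => ε * T / 2 < |Z R S - z R|) ≤
        32 * β / (ε ^ 2 * T) := by
    intro R hR
    refine (pmfProb_lt_abs_sub_le _ _ _ hdev).trans ?_
    rw [← hconst]
    refine div_le_div_of_nonneg_right ?_ (by positivity)
    refine (pmfMean_htEstimator_sub_sq_le p hp.ne' (List.nodup_finRange n) (crowdedQuads θ R σ)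
      (fun j _ v _ => by simp) (fun j _ => Finset.card_le_two.trans (by norm_num))
      (fun q _ => crowdedWeight_nonneg θ R σ q) (fun q _ => crowdedWeight_le_one θ R σ q) hβ0
      (crowded_overlap_le hσ hp p.2.2 hθ hR hβ)).trans ?_
    refine mul_le_mul_of_nonneg_left ?_ (by positivity)
    have := hyz R
    have := hy0 R
    change z R ≤ T
    linarith
  have hsplit : ∀ ω : Finset (Fin n) × Finset (Fin n) × Finset (Sym2 (Fin n)),
      ε * T < |(fourCycleAlgorithm n p θ).output (Memory.after θ O σ ω) - T| →
      (¬ GoodSample p θ σ ω.1) ∨ ((GoodSample p θ σ ω.1 ∧ ε * T / 2 < |Y ω.1 ω.2.2 - y ω.1|) ∨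
        (GoodSample p θ σ ω.1 ∧ ε * T / 2 < |Z ω.1 ω.2.1 - z ω.1|)) := by
    rintro ⟨R₁, R₂, S⟩ h
    rw [output_fourCycleAlgorithm] at h
    by_cases hg : GoodSample p θ σ R₁
    · right
      by_contra hcon
      push Not at hcon
      have h1 : |Y R₁ S - y R₁| ≤ ε * T / 2 := hcon.1 hg
      have h2 : |Z R₁ R₂ - z R₁| ≤ ε * T / 2 := hcon.2 hg
      have h3 : Y R₁ S + Z R₁ R₂ - T = (Y R₁ S - y R₁) + (Z R₁ R₂ - z R₁) := by
        rw [← hyz R₁]; ring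
      have h4 : ε * T < |Y R₁ S + Z R₁ R₂ - T| := h
      rw [h3] at h4
      have := abs_add_le (Y R₁ S - y R₁) (Z R₁ R₂ - z R₁)
      linarith
    · exact Or.inl hg
  refine (pmfProb_mono _ hsplit).trans ((pmfProb_or_le _ _ _).trans ?_)
  refine add_le_add ?_ ((pmfProb_or_le _ _ _).trans ?_)
  · refine le_trans (le_of_eq ?_) (pmfProb_not_goodSample_le p hp (by linarith) σ)
    unfold pmfProb
    exact pmfMean_samples_fst p σ fun R =>
      @ite ℝ (¬ GoodSample p θ σ R) (Classical.propDecidable _) 1 0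
  · have hnn : 0 ≤ 32 * β / (ε ^ 2 * T) := by positivity
    have hfalse : ∀ {Ω : Type} [Fintype Ω] (μ : PMF Ω), pmfProb μ (fun _ => False) ≤
        32 * β / (ε ^ 2 * T) := by
      intro Ω _ μ
      unfold pmfProb
      exact pmfMean_le_of_le μ fun _ => by simpa using hnn
    have h1 : pmfProb (samples p σ) (fun ω => GoodSample p θ σ ω.1 ∧
        ε * T / 2 < |Y ω.1 ω.2.2 - y ω.1|) ≤ 32 * β / (ε ^ 2 * T) := by
      rw [samples, pmfProb_pmfProd]
      refine pmfMean_le_of_le _ fun R₁ => ?_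
      rw [pmfProb_pmfProd]
      refine pmfMean_le_of_le _ fun R₂ => ?_
      by_cases hg : GoodSample p θ σ R₁
      · simpa only [hg, true_and] using hYdev R₁ hg
      · simpa only [hg, false_and] using hfalse _
    have h2 : pmfProb (samples p σ) (fun ω => GoodSample p θ σ ω.1 ∧
        ε * T / 2 < |Z ω.1 ω.2.1 - z ω.1|) ≤ 32 * β / (ε ^ 2 * T) := by
      rw [samples, pmfProb_pmfProd]
      refine pmfMean_le_of_le _ fun R₁ => ?_
      by_cases hg : GoodSample p θ σ R₁
      · have h := hZdev R₁ hg
        unfold pmfProb at h ⊢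
        rw [pmfMean_pmfProd]
        simpa only [hg, true_and, pmfMean_const] using h
      · simpa only [hg, false_and] using hfalse _
    calc _ ≤ 32 * β / (ε ^ 2 * T) + 32 * β / (ε ^ 2 * T) := add_le_add h1 h2
      _ = 64 * β / (ε ^ 2 * T) := by ring

end Accuracy

/-! ### Parameters -/

section Parameters

/-- The crowdedness threshold `θ`. Its size `C log n / ε²` serves Chernoff's bound through the
factor `log n`, and Chebyshev's inequality through `ε⁻²`; the variances are `O(B² T² / θ)`, which
gives the factor `B²`. -/
noncomputable def crowdThreshold (B : ℝ) (n : ℕ) (ε : ℝ) : ℝ :=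
  10485760 * B ^ 2 * Real.log n / ε ^ 2

/-- The sampling rate `min 1 (θ / Test ^ (1 / 3))`. -/
noncomputable def samplingRate (B : ℝ) (n : ℕ) (ε Test : ℝ) : unitInterval :=
  Set.projIcc 0 1 zero_le_one (crowdThreshold B n ε / Test ^ ((1 : ℝ) / 3))

/-- The properties of `p = min 1 (θ / r)`. If `p < 1`, then `1 / p = r / θ`, and if `p = 1`, then
`1 / p - 1` vanishes. -/
lemma projIcc_div_bounds {θ r : ℝ} (hθ : 0 < θ) (hr : 0 < r) {p : ℝ}
    (hp : p = (Set.projIcc (0 : ℝ) 1 zero_le_one (θ / r) : ℝ)) :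
    0 < p ∧ p ≤ 1 ∧ p ≤ θ / r ∧ p⁻¹ - 1 ≤ r / θ ∧ (p⁻¹ - 1) ^ 2 / p ≤ (r / θ) ^ 3 := by
  have hx : 0 < θ / r := by positivity
  rw [Set.coe_projIcc] at hp
  rcases le_total (θ / r) 1 with h | h
  · rw [min_eq_right h, max_eq_right hx.le] at hp
    subst hp
    have hinv : (θ / r)⁻¹ = r / θ := inv_div _ _
    have h1 : 1 ≤ r / θ := by rw [← hinv]; exact (one_le_inv₀ hx).2 h
    refine ⟨hx, h, le_rfl, by rw [hinv]; linarith, ?_⟩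
    rw [div_eq_mul_inv, hinv, pow_succ (r / θ) 2]
    gcongr
    linarith
  · rw [min_eq_left h, max_eq_right zero_le_one] at hp
    subst hp
    refine ⟨one_pos, le_rfl, h, ?_, ?_⟩ <;> norm_num <;> positivity

lemma rpow_third_pow_three {x : ℝ} (hx : 0 ≤ x) : (x ^ ((1 : ℝ) / 3)) ^ 3 = x := by
  rw [← Real.rpow_natCast, ← Real.rpow_mul hx]
  norm_num

lemma rpow_two_thirds {x : ℝ} (hx : 0 ≤ x) : x ^ ((2 : ℝ) / 3) = (x ^ ((1 : ℝ) / 3)) ^ 2 := by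
  rw [← Real.rpow_natCast, ← Real.rpow_mul hx]
  norm_num

lemma three_le_of_fourCycleCount {n : ℕ} {G : SimpleGraph (Fin n)} (hT : 1 ≤ fourCycleCount G) :
    3 ≤ n := by
  obtain ⟨C, hC⟩ := Finset.card_pos.1 hT
  obtain ⟨a, b, c, d, hab, hbc, -, -, hac, -⟩ := mem_fourCycles.1 hC
  have h : ({a, b, c} : Finset (Fin n)).card = 3 := by
    rw [Finset.card_insert_of_notMem, Finset.card_pair hbc.ne]
    simp [hab.ne, hac]
  rw [← h]
  simpa using Finset.card_le_univ ({a, b, c} : Finset (Fin n))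

lemma one_le_log {n : ℕ} (hn : 3 ≤ n) : 1 ≤ Real.log n := by
  have h3 : (3 : ℝ) ≤ n := by exact_mod_cast hn
  rw [Real.le_log_iff_exp_le (by linarith)]
  linarith [Real.exp_one_lt_d9]

lemma exp_neg_small {n : ℕ} (hn : 3 ≤ n) {θ : ℝ} (hθ : 16 * Real.log n ≤ θ) :
    (n : ℝ) ^ 4 * (2 * Real.exp (-(θ / 2))) ≤ 1 / 20 := by
  have h3 : (3 : ℝ) ≤ n := by exact_mod_cast hn
  have h0 : (0 : ℝ) < n := by linarith
  have h1 : Real.exp (-(θ / 2)) ≤ ((n : ℝ) ^ 8)⁻¹ := by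
    rw [← Real.exp_log (pow_pos h0 8), ← Real.exp_neg, Real.log_pow]
    apply Real.exp_le_exp.2
    push_cast
    linarith
  calc (n : ℝ) ^ 4 * (2 * Real.exp (-(θ / 2))) ≤ (n : ℝ) ^ 4 * (2 * ((n : ℝ) ^ 8)⁻¹) := by gcongr
    _ = 2 / (n : ℝ) ^ 4 := by field_simp
    _ ≤ 2 / 3 ^ 4 := by gcongr
    _ ≤ 1 / 20 := by norm_num

/-- A counter or an edge takes `O(log n)` bits. -/
lemma code_word_length_le {n : ℕ} (hn : 3 ≤ n) :
    (2 * ((2 * n ^ 4).size : ℝ) + 2) ≤ 24 * Real.log n := by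
  have hlog := one_le_log hn
  have h0 : (0 : ℝ) < n := by exact_mod_cast (by omega : 0 < n)
  have hN : 1 ≤ 2 * n ^ 4 := by
    have := Nat.pow_pos (n := 4) (show 0 < n by omega)
    omega
  have h := natSize_le_log hN
  push_cast at h
  rw [Real.log_mul (by norm_num) (by positivity), Real.log_pow] at h
  have h2 := Real.log_two_lt_d9
  push_cast at h
  nlinarith

/-- The number of vertices is polynomial in the space scale. -/
lemma log_le_log_spaceScale {n m : ℕ} {r ε : ℝ} (hn : 3 ≤ n) (hnm : n ≤ 2 * m) (hr : 1 ≤ r)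
    (hε : 0 < ε) (hε1 : ε < 1) :
    2 ≤ r + m / (ε ^ 2 * r) ∧ Real.log n ≤ 3 * Real.log (r + m / (ε ^ 2 * r)) := by
  have hm : (1 : ℝ) ≤ m := by exact_mod_cast (by omega : 1 ≤ m)
  have hnm' : (n : ℝ) ≤ 2 * m := by exact_mod_cast hnm
  have h0 : (0 : ℝ) < n := by exact_mod_cast (by omega : 0 < n)
  set f := r + m / (ε ^ 2 * r) with hf
  have h1 : m / r ≤ m / (ε ^ 2 * r) := by
    apply div_le_div_of_nonneg_left (by positivity) (by positivity)
    have : ε ^ 2 ≤ 1 := by nlinarith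
    nlinarith
  have h2 : r + m / r ≤ f := by rw [hf]; linarith
  have h3 : 4 * m ≤ f ^ 2 := by
    have h4 : (r + m / r) ^ 2 ≤ f ^ 2 := pow_le_pow_left₀ (by positivity) h2 2
    have h5 : r * (m / r) = m := by field_simp
    nlinarith [sq_nonneg (r - m / r)]
  have hf0 : 0 ≤ f := le_trans (by positivity) h2
  have hf2 : 2 ≤ f := by nlinarith
  refine ⟨hf2, ?_⟩
  have h6 : (n : ℝ) ≤ f ^ 3 := by nlinarith [sq_nonneg f]
  have h7 := Real.log_le_log h0 h6
  rw [Real.log_pow] at h7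
  exact_mod_cast h7

/-- There are `O(T ^ (1 / 3))` heavy edges. -/
lemma card_heavy_le {V : Type*} [Fintype V] [DecidableEq V] {G : SimpleGraph V}
    {σ : List (Sym2 V)} (hσ : IsEdgeStream G σ)
    {O : Sym2 V → Bool} {τ B r : ℝ} (hO : IsHeavyEdgeOracle G τ O) (hB : 0 < B) (hr : 0 < r)
    (hT : r ^ 3 = fourCycleCount G) (hτ : r ^ 2 / B ≤ τ) :
    ((σ.toFinset.filter fun e => O e = true).card : ℝ) ≤ 4 * B * r := by
  set H := σ.toFinset.filter fun e => O e = true with hH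
  have h1 : (∑ e ∈ H, (edgeFourCycleCount G e : ℝ)) ≤ 4 * r ^ 3 := by
    rw [hT]
    exact_mod_cast sum_edgeFourCycleCount_le G H
  have h2 : (H.card : ℝ) * (r ^ 2 / B) ≤ ∑ e ∈ H, (edgeFourCycleCount G e : ℝ) := by
    rw [← nsmul_eq_mul]
    refine Finset.card_nsmul_le_sum _ _ _ fun e he => ?_
    rw [hH, Finset.mem_filter, List.mem_toFinset, hσ.2] at he
    exact hτ.trans ((hO e he.1).1 he.2)
  have h3 := h2.trans h1
  rw [← mul_div_assoc, div_le_iff₀ hB] at h3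
  have h4 : (H.card : ℝ) * r ^ 2 ≤ (4 * B * r) * r ^ 2 := by linarith
  exact le_of_mul_le_mul_right h4 (by positivity)

/-- The arithmetic of the space bound; `h` is the number of heavy edges, `l` and `L` are the
logarithms of the number of vertices and of the space scale `r + g`. -/
lemma space_arith {D B l L r g pn pm h : ℝ} (hD : 0 ≤ D) (hB : 0 ≤ B) (hl : 1 ≤ l) (hlL : l ≤ 3 * L)
    (hr : 1 ≤ r) (hg : 0 ≤ g) (hpn : pn ≤ 2 * pm) (hpm : pm ≤ D * l * g) (hh : h ≤ 4 * B * r) :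
    (2 * pn + 5 * pm + h + 5) * (24 * l) + 5 ≤
      9 * (216 * D + 96 * B + 125) * (r + g) * L ^ 2 := by
  have h1 : 1 ≤ r * l := by nlinarith
  have h2 : 1 ≤ r * l ^ 2 := by nlinarith
  have h3 : 4 * B * r ≤ 4 * B * r * l := le_mul_of_one_le_right (by positivity) hl
  have h4 : 2 * pn + 5 * pm + h + 5 ≤ 9 * (D * l * g) + 4 * B * r * l + 5 * (r * l) := by linarith
  have h5 : 216 * D * g + (96 * B + 125) * r ≤ (216 * D + 96 * B + 125) * (r + g) := by
    have h6 : 0 ≤ D * r := by positivity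
    have h7 : 0 ≤ B * g := by positivity
    linarith
  calc (2 * pn + 5 * pm + h + 5) * (24 * l) + 5
      ≤ (9 * (D * l * g) + 4 * B * r * l + 5 * (r * l)) * (24 * l) + 5 * (r * l ^ 2) := by
        have := mul_le_mul_of_nonneg_right h4 (show 0 ≤ 24 * l by linarith)
        linarith
    _ = (216 * D * g + (96 * B + 125) * r) * l ^ 2 := by ring
    _ ≤ ((216 * D + 96 * B + 125) * (r + g)) * (3 * L) ^ 2 := by
        refine mul_le_mul h5 (pow_le_pow_left₀ (by linarith) hlL 2) (by positivity) (by positivity)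
    _ = 9 * (216 * D + 96 * B + 125) * (r + g) * L ^ 2 := by ring

/-- The arithmetic of the overlap bound for sparse quadruples; `x` stands for `1 / p - 1`, `r` and
`t` for the cube roots of `T` and of its approximation. -/
lemma overlap_arith {B T Test τ θ p x r t : ℝ} (hθ : 1 ≤ θ) (hx : 0 ≤ x) (hx1 : x ≤ t / θ)
    (hx2 : x ^ 2 / p ≤ (t / θ) ^ 3) (hr : 1 ≤ r) (hT : 0 ≤ T) (ht : 0 ≤ t) (htr : t ≤ B * r)
    (hB : 1 ≤ B) (hTest : Test ≤ B ^ 2 * T) (hr3 : r ^ 3 = T) (ht3 : t ^ 3 = Test)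
    (hτ : τ ≤ B * r ^ 2) :
    x * (256 * τ) ≤ 16384 * B ^ 2 * T / θ ∧ x ^ 2 * 256 ≤ 16384 * B ^ 2 * T / θ ∧
      x ^ 3 * 256 ≤ 16384 * B ^ 2 * T / θ ∧
        x ^ 2 * (256 * (4 * θ / p)) ≤ 16384 * B ^ 2 * T / θ := by
  have hθ0 : 0 < θ := by linarith
  have hb0 : 0 ≤ B ^ 2 * T / θ := by positivity
  have hβ : 16384 * B ^ 2 * T / θ = 16384 * (B ^ 2 * T / θ) := by ring
  have hxr : x ≤ B * r / θ := hx1.trans (by gcongr)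
  have hcube : (t / θ) ^ 3 * θ ≤ B ^ 2 * T / θ := by
    rw [div_pow, ht3]
    calc Test / θ ^ 3 * θ = Test / θ ^ 2 := by field_simp
      _ ≤ (B ^ 2 * T) / θ ^ 2 := by gcongr
      _ ≤ (B ^ 2 * T) / θ := by gcongr; nlinarith
  have hcube' : (t / θ) ^ 3 ≤ (t / θ) ^ 3 * θ := le_mul_of_one_le_right (by positivity) hθ
  rw [hβ]
  refine ⟨?_, ?_, ?_, ?_⟩
  · calc x * (256 * τ) ≤ x * (256 * (B * r ^ 2)) := by gcongr
      _ ≤ (B * r / θ) * (256 * (B * r ^ 2)) := by gcongr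
      _ = 256 * (B ^ 2 * r ^ 3 / θ) := by ring
      _ ≤ _ := by rw [hr3]; linarith
  · calc x ^ 2 * 256 ≤ (B * r / θ) ^ 2 * 256 := by gcongr
      _ = 256 * (B ^ 2 * r ^ 2 / θ ^ 2) := by ring
      _ ≤ 256 * (B ^ 2 * r ^ 3 / θ) := by
        gcongr
        · norm_num
        · nlinarith
      _ ≤ _ := by rw [hr3]; linarith
  · calc x ^ 3 * 256 ≤ (t / θ) ^ 3 * 256 := by gcongr
      _ ≤ _ := by linarith
  · calc x ^ 2 * (256 * (4 * θ / p)) = 1024 * ((x ^ 2 / p) * θ) := by ring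
      _ ≤ 1024 * ((t / θ) ^ 3 * θ) := by gcongr
      _ ≤ _ := by linarith

/-- The arithmetic of Chebyshev's bound. -/
lemma chebyshev_arith {B l θ ε T : ℝ} (hB : 0 < B) (hl : 1 ≤ l) (hε : 0 < ε) (hθ : 0 < θ)
    (hT : 0 < T) (hθε : θ * ε ^ 2 = 10485760 * B ^ 2 * l) :
    64 * (16384 * B ^ 2 * T / θ) / (ε ^ 2 * T) ≤ 1 / 10 := by
  have h : 64 * (16384 * B ^ 2 * T / θ) / (ε ^ 2 * T) = 1048576 * B ^ 2 / (θ * ε ^ 2) := by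
    field_simp
    norm_num
  rw [h, hθε, div_le_iff₀ (by positivity)]
  have : B ^ 2 ≤ B ^ 2 * l := le_mul_of_one_le_right (by positivity) hl
  linarith

end Parameters

/-! ### Space and success probability -/

lemma pmfMean_peakMemory_le {n : ℕ} (hn : 3 ≤ n) (p : unitInterval) (θ : ℝ)
    (O : Sym2 (Fin n) → Bool) {σ : List (Sym2 (Fin n))} (hσ : σ.Nodup) :
    pmfMean (samples p σ) (fun ω => (peakMemory θ O σ ω : ℝ)) ≤
      (2 * (p * n) + 5 * (p * σ.length) + (σ.toFinset.filter fun e => O e = true).card + 5) *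
        (24 * Real.log n) + 5 := by
  set L : ℝ := 2 * ((2 * n ^ 4).size : ℝ) + 2 with hL
  have hL0 : 0 ≤ L := by positivity
  have h1 : ∀ ω, (peakMemory θ O σ ω : ℝ) ≤ L * (Memory.stored O σ ω : ℝ) + (5 * L + 5) := by
    intro ω
    have h : (peakMemory θ O σ ω : ℝ) ≤ ((Memory.stored O σ ω : ℝ) + 5) * L + 5 := by
      rw [hL]
      exact_mod_cast peakMemory_le θ O σ ω
    linarith
  refine (pmfMean_mono _ h1).trans ?_
  rw [pmfMean_add, pmfMean_const, pmfMean_mul_left]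
  have h2 := pmfMean_stored_le p O hσ
  have h3 := mul_le_mul_of_nonneg_left h2 hL0
  have h4 := code_word_length_le hn
  rw [← hL] at h4
  have hp := p.2.1
  have h5 : 0 ≤ 2 * ((p : ℝ) * n) + 5 * (p * σ.length) +
      (σ.toFinset.filter fun e => O e = true).card + 5 := by positivity
  have h6 := mul_le_mul_of_nonneg_left h4 h5
  linarith

/-- Combines an error bound with Markov's inequality for the space. -/
lemma seven_tenths_le_pmfProb {Ω : Type*} [Fintype Ω] (μ : PMF Ω) (err : Ω → ℝ) (space : Ω → ℕ)
    {δ s : ℝ} (herr : pmfProb μ (fun ω => δ < err ω) ≤ 1 / 20 + 1 / 10) (hs : 0 < s)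
    (hspace : 20 * pmfMean μ (fun ω => (space ω : ℝ)) ≤ s) :
    7 / 10 ≤ pmfProb μ (fun ω => err ω ≤ δ ∧ (space ω : ℝ) ≤ s) := by
  have h1 : pmfProb μ (fun ω => s < (space ω : ℝ)) ≤ 1 / 20 := by
    refine (pmfProb_le_div _ (fun ω => (space ω : ℝ)) (fun _ => Nat.cast_nonneg _) hs
      fun ω h => h.le).trans ?_
    rw [div_le_iff₀ hs]
    linarith
  have h2 := pmfProb_or_le μ (fun ω => δ < err ω) (fun ω => s < (space ω : ℝ))
  have h3 := pmfProb_not μ (fun ω => δ < err ω ∨ s < (space ω : ℝ))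
  simp only [not_or, not_lt] at h3
  linarith

theorem theorem3 (B : ℝ) (hB : 1 ≤ B) :
    ∃ (A : (n : ℕ) → (ε : ℝ) → (Test : ℝ) → OracleStreamAlgorithm n) (K : ℝ) (k : ℕ),
      ∀ (n : ℕ) (G : SimpleGraph (Fin n)) (σ : List (Sym2 (Fin n))) (O : Sym2 (Fin n) → Bool)
        (m T : ℕ) (ε Test τ : ℝ),
        IsEdgeStream G σ →
        m = σ.length →
        n ≤ 2 * m →
        T = fourCycleCount G →
        1 ≤ T →
        0 < ε → ε < 1 →
        (T : ℝ) / B ≤ Test → Test ≤ B * (T : ℝ) →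
        (T : ℝ) ^ ((2 : ℝ) / 3) / B ≤ τ → τ ≤ B * (T : ℝ) ^ ((2 : ℝ) / 3) →
        IsHeavyEdgeOracle G τ O →
        (A n ε Test).expectedSpace O σ ≤
            ENNReal.ofReal (K * spaceScale m T ε * Real.log (spaceScale m T ε) ^ k) ∧
        7 / 10 ≤ (A n ε Test).successProb O σ ε T
            (K * spaceScale m T ε * Real.log (spaceScale m T ε) ^ k) := by
  -- `K = 20 * 9 * K₀`: Markov's inequality costs the factor 20, and `log n ≤ 3 log f` the factor 9
  set C : ℝ := 10485760 * B ^ 2 with hC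
  set K₀ : ℝ := 216 * (C * B) + 96 * B + 125 with hK₀
  refine ⟨fun n ε Test => fourCycleAlgorithm n (samplingRate B n ε Test) (crowdThreshold B n ε),
    180 * K₀, 2, ?_⟩
  intro n G σ O m T ε Test τ hσ hm hnm hTG hT hε hε1 hTest1 hTest2 hτ1 hτ2 hO
  have hn : 3 ≤ n := three_le_of_fourCycleCount (hTG ▸ hT)
  have hlog := one_le_log hn
  have hB0 : 0 < B := by linarith
  have hT1 : (1 : ℝ) ≤ T := by exact_mod_cast hT
  have hT0 : (0 : ℝ) < T := by linarith
  have hTest0 : 0 < Test := lt_of_lt_of_le (by positivity) hTest1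
  -- the cube roots of `T` and of its approximation
  set r : ℝ := (T : ℝ) ^ ((1 : ℝ) / 3) with hr
  set t : ℝ := Test ^ ((1 : ℝ) / 3) with ht
  have hr1 : 1 ≤ r := Real.one_le_rpow hT1 (by norm_num)
  have hr0 : 0 < r := by linarith
  have ht0 : 0 < t := Real.rpow_pos_of_pos hTest0 _
  have hr3 : r ^ 3 = T := rpow_third_pow_three hT0.le
  have ht3 : t ^ 3 = Test := rpow_third_pow_three hTest0.le
  rw [rpow_two_thirds hT0.le, ← hr] at hτ1 hτ2
  have hB3 : B ≤ B ^ 3 := le_self_pow₀ hB (by norm_num)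
  have htr : t ≤ B * r := by
    refine le_of_pow_le_pow_left₀ (n := 3) (by norm_num) (by positivity) ?_
    rw [mul_pow, ht3, hr3]
    exact hTest2.trans (mul_le_mul_of_nonneg_right hB3 hT0.le)
  have hrt : r ≤ B * t := by
    refine le_of_pow_le_pow_left₀ (n := 3) (by norm_num) (by positivity) ?_
    rw [mul_pow, ht3, hr3]
    rw [div_le_iff₀ hB0] at hTest1
    nlinarith
  -- threshold and rate
  set θ : ℝ := crowdThreshold B n ε with hθ
  set p : unitInterval := samplingRate B n ε Test with hp
  have hC16 : 10485760 ≤ C := by rw [hC]; nlinarith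
  have hθε : θ * ε ^ 2 = C * Real.log n := by
    rw [hθ, crowdThreshold, ← hC]; field_simp
  have hθlog : C * Real.log n ≤ θ := by
    rw [← hθε]
    have h0 : 0 ≤ θ := by rw [hθ, crowdThreshold]; positivity
    have : ε ^ 2 ≤ 1 := by nlinarith
    exact mul_le_of_le_one_right h0 this
  have hθ16 : 16 * Real.log n ≤ θ := by nlinarith
  have hθ1 : 1 ≤ θ := by linarith
  have hθ0 : 0 < θ := by linarith
  obtain ⟨hp0, hp1, hpθ, hx1, hx2⟩ := projIcc_div_bounds hθ0 ht0 (p := (p : ℝ)) rfl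
  have hx0 : 0 ≤ (p : ℝ)⁻¹ - 1 := sub_nonneg.2 ((one_le_inv₀ hp0).2 hp1)
  -- the space bound
  set f : ℝ := spaceScale m T ε with hf
  have hfr : f = r + m / (ε ^ 2 * r) := rfl
  obtain ⟨hf2, hlogf⟩ := log_le_log_spaceScale hn hnm hr1 hε hε1
  rw [← hfr] at hf2 hlogf
  have hmean : pmfMean (samples p σ) (fun ω => (peakMemory θ O σ ω : ℝ)) ≤
      9 * K₀ * f * Real.log f ^ 2 := by
    refine (pmfMean_peakMemory_le hn p θ O hσ.1).trans ?_
    have hheavy := card_heavy_le hσ hO hB0 hr0 (by rw [hr3, hTG]) hτ1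
    rw [← hm]
    have hpn : (p : ℝ) * n ≤ 2 * (p * m) := by
      have hnm' : (n : ℝ) ≤ 2 * m := by exact_mod_cast hnm
      nlinarith
    have hpr : (p : ℝ) ≤ C * B * Real.log n / (ε ^ 2 * r) := by
      refine hpθ.trans ?_
      rw [div_le_div_iff₀ ht0 (by positivity)]
      calc θ * (ε ^ 2 * r) = (C * Real.log n) * r := by rw [← hθε]; ring
        _ ≤ (C * Real.log n) * (B * t) := by gcongr
        _ = _ := by ring
    have hpm : (p : ℝ) * m ≤ (C * B * Real.log n) * (m / (ε ^ 2 * r)) := by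
      calc (p : ℝ) * m ≤ (C * B * Real.log n / (ε ^ 2 * r)) * m := by gcongr
        _ = _ := by ring
    exact space_arith (by positivity) hB0.le hlog hlogf hr1 (by positivity) hpn hpm hheavy
  have hlogf0 : 0 < Real.log f := Real.log_pos (by linarith)
  have hK₀0 : 0 < K₀ := by positivity
  have hs0 : 0 < 9 * K₀ * f * Real.log f ^ 2 := by positivity
  set s : ℝ := 180 * K₀ * f * Real.log f ^ 2 with hs
  have hs20 : s = 20 * (9 * K₀ * f * Real.log f ^ 2) := by rw [hs]; ring
  refine ⟨?_, ?_⟩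
  · rw [expectedSpace_fourCycleAlgorithm _ _ _ hσ.1]
    exact ENNReal.ofReal_le_ofReal (by linarith)
  rw [successProb_fourCycleAlgorithm _ _ _ hσ.1]
  have hB2 : 1 ≤ B ^ 2 := one_le_pow₀ hB
  have hBB2 : B ≤ B ^ 2 := le_self_pow₀ hB (by norm_num)
  obtain ⟨h1, h2, h3, h4⟩ := overlap_arith hθ1 hx0 hx1 hx2 hr1 hT0.le ht0.le htr hB
    (hTest2.trans (mul_le_mul_of_nonneg_right hBB2 hT0.le)) hr3 ht3 hτ2
  have hβ : 16384 * (fourCycleCount G : ℝ) / θ ≤ 16384 * B ^ 2 * T / θ := by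
    rw [← hTG]
    gcongr
    linarith
  have hacc := pmfProb_output_error_le hσ p hp0 hθ1 O (by positivity) hε (hTG ▸ hT)
    (fun R hR => sparse_overlap_le hσ hp0 hp1 hθ0.le hR hO h1 h2 h3 h4) hβ
  rw [← hTG] at hacc
  have hfinal := seven_tenths_le_pmfProb (samples p σ)
    (fun ω => |(fourCycleAlgorithm n p θ).output (Memory.after θ O σ ω) - T|) (peakMemory θ O σ)
    (hacc.trans (add_le_add (exp_neg_small hn hθ16)
      (chebyshev_arith hB0 hlog hε hθ0 hT0 hθε))) (s := s) (by linarith) (by linarith)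
  calc (7 / 10 : ℝ≥0∞) = ENNReal.ofReal (7 / 10) := by
        rw [ENNReal.ofReal_div_of_pos (by norm_num)]
        norm_num
    _ ≤ _ := ENNReal.ofReal_le_ofReal hfinal
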